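/- Let $T$ be a skew field, $m\ge 1$, and let $R=\mathrm{M}(m,T)$ be the full matrix ring over $T$; assume that $R$ is not isomorphic to any of $\mathbb F_2,\mathbb F_3,\mathbb F_4,\mathbb F_5,\mathrm{M}(2,\mathbb F_2)$. Let $n\ge 2$, let $M$ be a free right $R$-module with basis $b_1,\dots,b_n$, let $L$ be the lattice of right submodules of $M$, and put $e_i=b_iR$. Let $L_0$ be the sublattice of $L$ generated by $e_1,\dots,e_n$, and let $G=\operatorname{Aut}(L)$ be the group of all lattice automorphisms of $L$. For $S\subseteq L$ let $G(S)$ be the subgroup of all $g\in G$ with $g(x)=x$ for every $x\in S$. Put $H=G(L_0)$ and $L_0'=\{x\in L: h(x)=x \text{ for all } h\in H\}$. A $D$-net of two-sided ideals in $R$ of order $n$ is a family $\sigma=(\sigma_{ij})_{i,j=1}^n$ of two-sided ideals of $R$ with $\sigma_{ik}\sigma_{kj}\subseteq\sigma_{ij}$ for all $i,j,k$ and $\sigma_{ii}=R$ for all $i$. Its transpose is the family $\sigma^{\mathrm T}=(\tau_{ij})$ of submodules $\tau_{ij}=b_j\sigma_{ji}\le e_j$, and $K_\sigma$ denotes the sublattice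 of $L$ generated by the elements $\sum_{j=1}^n\tau_{ij}$, $i=1,\dots,n$. For $x\in L$ write $[x]_j=\bigl(x+\sum_{l\ne j}e_l\bigr)\cap e_j$. A family $(\tau_{ij})_{i,j=1}^n$ of elements of $L$ is a net collection in $L_0'$ if for all $i,j$ and all $g\in G$: $\tau_{ij}\le e_j$; $\tau_{ii}=e_i$; $\tau_{ij}\in L_0'$; and $[g(e_i)]_j\le\tau_{ij}$ holds if and only if $[g(\tau_{ki})]_j\le\tau_{kj}$ for all $k$. Then $\sigma^{\mathrm T}$ is a net collection in $L_0'$ for every $D$-net $\sigma$ of two-sided ideals in $R$ of order $n$; and for every subgroup $F$ with $H\le F\le G$ there exists a unique $D$-net $\sigma$ of two-sided ideals in $R$ of order $n$ such that $$G(K_\sigma)\le F\le N_G\bigl(G(K_\sigma)\bigr),$$ where $N_G$ denotes the normaliser in $G$. -/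

import Mathlib

namespace LatticeNets

universe u v

section Lattice

variable {L : Type u}

/-- The group `G(S)` of all automorphisms of the lattice `L` that fix every element of `S`
(here `G = Aut(L)` is the group of all lattice automorphisms, i.e. order automorphisms). -/
def pointwiseStabilizer [Lattice L] (S : Set L) : Subgroup (L ≃o L) :=
  fixingSubgroup (L ≃o L) S

/-- The sublattice `L(F)` of all elements of `L` fixed by every automorphism in `F`. -/
def fixedSublattice [Lattice L] (F : Subgroup (L ≃o L)) : Sublattice L where
  carrier := {x | ∀ f ∈ F, f x = x}
  supClosed' := by
    intro x hx y hy f hf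
    rw [map_sup, hx f hf, hy f hf]
  infClosed' := by
    intro x hx y hy f hf
    rw [map_inf, hx f hf, hy f hf]

variable [CompleteLattice L] {n : ℕ}

/-- The `i`-th coordinate `[x]_i = (x + ∑_{j ≠ i} e_j) ∩ e_i` of the support of `x` with respect
to the elements `e_1, …, e_n`. -/
def support (e : Fin n → L) (x : L) (i : Fin n) : L :=
  (x ⊔ ⨆ j : {j : Fin n // j ≠ i}, e j) ⊓ e i

/-- The group `H = G(L_0)`, where `L_0` is the sublattice of `L` generated by `e_1, …, e_n`. -/
def diagonalSubgroup (e : Fin n → L) : Subgroup (L ≃o L) :=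
  pointwiseStabilizer (latticeClosure (Set.range e))

/-- Net collections in `L(H)`, where `H = G(L_0)`, with respect to the group `G = Aut(L)`. -/
structure IsNetCollection (e : Fin n → L) (τ : Fin n → Fin n → L) : Prop where
  le_atom : ∀ i j, τ i j ≤ e j
  diag : ∀ i, τ i i = e i
  mem_fixed : ∀ i j, τ i j ∈ fixedSublattice (diagonalSubgroup e)
  support_iff : ∀ (i j : Fin n) (g : L ≃o L),
    support e (g (e i)) j ≤ τ i j ↔ ∀ k, support e (g (τ k i)) j ≤ τ k j

/-- The lattice `K_τ` associated with a collection `τ`: the sublattice generated by the elements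
`∑_j τ_{ij}`, `i = 1, …, n`. -/
def associatedLattice (τ : Fin n → Fin n → L) : Set L :=
  latticeClosure (Set.range fun i => ⨆ j, τ i j)

end Lattice

section Nets

variable {R : Type u} [Ring R] {n : ℕ}

/-- A `D`-net of two-sided ideals of `R` of order `n`: `σ_{ik} σ_{kj} ⊆ σ_{ij}` for all `i, j, k`,
and `σ_{ii} = R` for all `i`. -/
structure IsDNet (σ : Fin n → Fin n → TwoSidedIdeal R) : Prop where
  mul_mem : ∀ i k j, ∀ a ∈ σ i k, ∀ b ∈ σ k j, a * b ∈ σ i j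
  diag : ∀ i, σ i i = ⊤

variable {M : Type v} [AddCommGroup M] [Module Rᵐᵒᵖ M]

/-- The lines `e_i = b_i R` spanned by the members of a basis of a right `R`-module. -/
def basisLine (b : Module.Basis (Fin n) Rᵐᵒᵖ M) (i : Fin n) : Submodule Rᵐᵒᵖ M :=
  Submodule.span Rᵐᵒᵖ {b i}

/-- The collection `σᵀ` of right submodules: its `(i, j)` member is `b_j σ_{ji} ≤ e_j`. -/
def transposedCollection (b : Module.Basis (Fin n) Rᵐᵒᵖ M)
    (σ : Fin n → Fin n → TwoSidedIdeal R) (i j : Fin n) : Submodule Rᵐᵒᵖ M :=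
  Submodule.span Rᵐᵒᵖ {x | ∃ r ∈ σ j i, x = MulOpposite.op r • b j}

/-- The lattice `K_σ` associated with the net collection `σᵀ`. -/
def netLattice (b : Module.Basis (Fin n) Rᵐᵒᵖ M)
    (σ : Fin n → Fin n → TwoSidedIdeal R) : Set (Submodule Rᵐᵒᵖ M) :=
  associatedLattice (transposedCollection b σ)

end Nets

end LatticeNets

/-! Since `R` is simple, each ideal of a net is `0` or `R`, so a `D`-net is the same as a preorder
`r` on the index set. Passing to columns (Morita equivalence) identifies the submodules of `M` with
the subspaces of `W^n`, where `W` is an `m`-dimensional space over `D = Tᵐᵒᵖ`; the `e_i` become the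
`n` summands, and `K_σ` is generated by the coordinate subspaces with index sets `{j | r j k}`.

A lattice automorphism preserves dimension and independence, so on the summands it agrees with some
linear automorphism. Hence an overgroup `F` of `H` is determined by its linear part `S`, a group
containing `GL(W)^n`. Let `r i j` mean that `i = j` or that `S` contains all transvections `1 +
E_ij(a)`; commutators make this a preorder.

The main step is extraction (`transvectionRel_of_conj`): a conjugate in `S` of a block diagonal
rank-one transformation has the form `1 + v ⊗ u`, and whenever `u_i ≠ 0` and `v_j ≠ 0` the group
contains all transvections in position `(i, j)`. If `dim W ≥ 2`, two commutators with block diagonal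
elements suffice. If `dim W = 1`, the whole family of dilations along `u` is available, and
conjugating with suitable scalars brings the products `u_r v_r` into good position. The excluded
rings are those with too few scalars for this.

Extraction shows that `F` permutes the coordinate subspaces of `r`-closed index sets, so `F`
normalises `G(K_σ)` (`le_normalizer`). Gaussian elimination within `S` (`mem_of_preservesPrincipal`)
gives `G(K_σ) ≤ F` (`stabilizer_le`). For uniqueness (`relation_le_of_normalizes`), a transvection
normalising the stabiliser of another preorder must send its principal subspaces to coordinate
subspaces, which forces one preorder into the other. -/

namespace LatticeNets

/-! ### Block transvections and the preorder of an overgroup. -/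

section Transvections

variable {D W ι : Type*} [DivisionRing D] [AddCommGroup W] [Module D W] [DecidableEq ι]

/-- The general linear group is transitive on nonzero vectors. -/
theorem exists_linearEquiv_apply_eq {w w' : W} (hw : w ≠ 0) (hw' : w' ≠ 0) :
    ∃ d : W ≃ₗ[D] W, d w = w' := by
  obtain ⟨g, hg⟩ := Submodule.exists_linearEquiv_restrict_eq
    ((LinearEquiv.toSpanNonzeroSingleton D W w hw).symm ≪≫ₗ
      LinearEquiv.toSpanNonzeroSingleton D W w' hw')
  refine ⟨g, ?_⟩
  have h := hg ⟨w, Submodule.mem_span_singleton_self w⟩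
  have h1 : (LinearEquiv.toSpanNonzeroSingleton D W w hw).symm
      ⟨w, Submodule.mem_span_singleton_self w⟩ = 1 := by
    rw [LinearEquiv.symm_apply_eq]
    ext; simp
  rw [LinearEquiv.trans_apply, h1] at h
  simpa using h.symm

/-- The general linear group is transitive on nonzero functionals up to a scalar. -/
theorem exists_linearEquiv_dual_comp_eq [Module.Finite D W] {φ ψ : W →ₗ[D] D} (hφ : φ ≠ 0) (hψ : ψ ≠ 0) :
    ∃ (d : W ≃ₗ[D] W) (c : D), ∀ x, ψ (d x) = φ x * c := by
  have hk : Module.finrank D (LinearMap.ker φ) = Module.finrank D (LinearMap.ker ψ) := by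
    have h1 := LinearMap.finrank_range_add_finrank_ker φ
    have h2 := LinearMap.finrank_range_add_finrank_ker ψ
    rw [LinearMap.range_eq_top.2 (LinearMap.surjective hφ)] at h1
    rw [LinearMap.range_eq_top.2 (LinearMap.surjective hψ)] at h2
    omega
  -- An isomorphism of the two kernels extends to all of `W`; the scalar then records its effect on
  -- a vector `w` with `φ w = 1`.
  obtain ⟨g, hg⟩ := Submodule.exists_linearEquiv_restrict_eq (LinearEquiv.ofFinrankEq _ _ hk)
  obtain ⟨w, hw⟩ := LinearMap.surjective hφ 1
  refine ⟨g, ψ (g w), fun x => ?_⟩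
  have hx : x - φ x • w ∈ LinearMap.ker φ := by simp [hw]
  have h := hg ⟨_, hx⟩
  have h2 : ψ (g (x - φ x • w)) = 0 := by
    rw [← LinearMap.mem_ker]
    have := (LinearEquiv.ofFinrankEq _ _ hk ⟨_, hx⟩ : LinearMap.ker ψ).2
    rw [h] at this
    exact this
  simpa [sub_eq_zero] using h2

/-- The endomorphism of `ι → W` with the single block `a` in position `(i, j)`. -/
def blockEnd (i j : ι) (a : Module.End D W) : Module.End D (ι → W) :=
  LinearMap.single D (fun _ => W) i ∘ₗ a ∘ₗ LinearMap.proj j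

@[simp] theorem blockEnd_apply (i j : ι) (a : Module.End D W) (x : ι → W) :
    blockEnd i j a x = Pi.single i (a (x j)) := rfl

theorem blockEnd_mul_blockEnd (i j l : ι) (a b : Module.End D W) :
    blockEnd i j a * blockEnd j l b = blockEnd i l (a * b) := by
  apply LinearMap.ext; intro x; simp

theorem blockEnd_mul_blockEnd_of_ne {j k : ι} (i l : ι) (h : j ≠ k) (a b : Module.End D W) :
    blockEnd i j a * blockEnd k l b = 0 := by
  apply LinearMap.ext; intro x; simp [h]

theorem blockEnd_add (i j : ι) (a b : Module.End D W) :
    blockEnd i j (a + b) = blockEnd i j a + blockEnd i j b := by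
  apply LinearMap.ext; intro x; simp [Pi.single_add]

theorem blockEnd_neg (i j : ι) (a : Module.End D W) :
    blockEnd i j (-a) = -blockEnd i j a := by
  apply LinearMap.ext; intro x; simp [Pi.single_neg]

theorem blockEnd_zero (i j : ι) : blockEnd i j (0 : Module.End D W) = 0 := by
  apply LinearMap.ext; intro x; simp

/-- The linear automorphism `d` of `W` acting on the `i`-th coordinate. -/
def blockDiag (i : ι) (d : W ≃ₗ[D] W) : Module.End D (ι → W) :=
  1 + blockEnd i i ((d : W →ₗ[D] W) - 1)

theorem blockDiag_apply_self (i : ι) (d : W ≃ₗ[D] W) (x : ι → W) :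
    blockDiag i d x i = d (x i) := by
  simp [blockDiag]

theorem blockDiag_apply_of_ne {i j : ι} (h : j ≠ i) (d : W ≃ₗ[D] W) (x : ι → W) :
    blockDiag i d x j = x j := by
  simp [blockDiag, h]

theorem blockDiag_single_self (i : ι) (d : W ≃ₗ[D] W) (w : W) :
    blockDiag i d (Pi.single i w) = Pi.single i (d w) := by
  simp [blockDiag, ← Pi.single_add]

theorem blockDiag_single_of_ne {i j : ι} (h : j ≠ i) (d : W ≃ₗ[D] W) (w : W) :
    blockDiag i d (Pi.single j w) = Pi.single j w := by
  simp [blockDiag, Pi.single_eq_of_ne h.symm]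

theorem blockDiag_mul_symm (i : ι) (d : W ≃ₗ[D] W) : blockDiag i d * blockDiag i d.symm = 1 := by
  apply LinearMap.ext; intro x
  ext j
  rw [Module.End.mul_apply]
  by_cases h : j = i
  · subst h; simp [blockDiag_apply_self]
  · simp [blockDiag_apply_of_ne h]

theorem blockDiag_symm_mul (i : ι) (d : W ≃ₗ[D] W) : blockDiag i d.symm * blockDiag i d = 1 := by
  simpa using blockDiag_mul_symm i d.symm

/-- A submonoid of endomorphisms which comes from a group of automorphisms that contains all
block diagonal automorphisms. -/
structure ContainsDiagonal (S : Submonoid (Module.End D (ι → W))) : Prop where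
  exists_inv : ∀ A ∈ S, ∃ B ∈ S, A * B = 1 ∧ B * A = 1
  diag_mem : ∀ (i : ι) (d : W ≃ₗ[D] W), blockDiag i d ∈ S

/-- The preorder attached to a group containing the block diagonal group: `i` and `j` are related
if the group contains all transvections in position `(i, j)`. -/
def transvectionRel (S : Submonoid (Module.End D (ι → W))) (i j : ι) : Prop :=
  i = j ∨ ∀ a : Module.End D W, 1 + blockEnd i j a ∈ S

variable {S : Submonoid (Module.End D (ι → W))}

theorem ContainsDiagonal.inv_mem (hS : ContainsDiagonal S) {A B : Module.End D (ι → W)}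
    (hA : A ∈ S) (hAB : A * B = 1) : B ∈ S := by
  obtain ⟨C, hC, -, hCA⟩ := hS.exists_inv A hA
  rwa [← left_inv_eq_right_inv hCA hAB]

theorem ContainsDiagonal.conj_mem (hS : ContainsDiagonal S) {A B X : Module.End D (ι → W)}
    (hA : A ∈ S) (hAB : A * B = 1) (hX : X ∈ S) : A * X * B ∈ S :=
  S.mul_mem (S.mul_mem hA hX) (hS.inv_mem hA hAB)

/-- The commutator formula for transvections, which gives transitivity of `transvectionRel`. -/
theorem one_add_mul_one_sub_comm {E : Type*} [Ring E] {X Y : E} (hX : X * X = 0) (hY : Y * Y = 0)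
    (hYX : Y * X = 0) : (1 + X) * (1 + Y) * (1 - X) * (1 - Y) = 1 + X * Y := by
  have : (1 + X) * (1 + Y) * (1 - X) * (1 - Y) =
    1 + X * Y - X * X - Y * Y - Y * X + X * X * Y - X * (Y * Y) - X * (Y * X) + (Y * X) * Y
      + X * (Y * X) * Y := by
    noncomm_ring
  rw [this]
  simp [hX, hY, hYX]

theorem transvectionRel.trans {i j k : ι} (hij : transvectionRel S i j)
    (hjk : transvectionRel S j k) : transvectionRel S i k := by
  rcases hij with rfl | hij
  · exact hjk
  rcases hjk with rfl | hjk
  · exact Or.inr hij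
  by_cases hik : i = k
  · exact Or.inl hik
  by_cases h1 : i = j
  · subst h1; exact Or.inr hjk
  by_cases h2 : j = k
  · subst h2; exact Or.inr hij
  refine Or.inr fun a => ?_
  have key := one_add_mul_one_sub_comm (X := blockEnd i j a)
    (Y := blockEnd j k (1 : Module.End D W))
    (blockEnd_mul_blockEnd_of_ne _ _ (Ne.symm h1) _ _)
    (blockEnd_mul_blockEnd_of_ne _ _ (Ne.symm h2) _ _)
    (blockEnd_mul_blockEnd_of_ne _ _ (Ne.symm hik) _ _)
  rw [blockEnd_mul_blockEnd, mul_one] at key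
  rw [← key, sub_eq_add_neg, sub_eq_add_neg, ← blockEnd_neg, ← blockEnd_neg]
  exact S.mul_mem (S.mul_mem (S.mul_mem (hij _) (hjk _)) (hij _)) (hjk _)

theorem one_add_blockEnd_mul {i j : ι} (h : i ≠ j) (a b : Module.End D W) :
    (1 + blockEnd i j a) * (1 + blockEnd i j b) = 1 + blockEnd i j (a + b) := by
  rw [blockEnd_add, mul_add, add_mul, add_mul, blockEnd_mul_blockEnd_of_ne _ _ h.symm]
  simp [add_assoc]

/-- A single transvection of rank one in a position forces all transvections in it. -/
theorem transvectionRel_of_rankOne [Module.Finite D W] (hS : ContainsDiagonal S) {i j : ι} (hij : i ≠ j)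
    {φ : W →ₗ[D] D} {w : W} (hφ : φ ≠ 0) (hw : w ≠ 0)
    (h : 1 + blockEnd i j (φ.smulRight w) ∈ S) : transvectionRel S i j := by
  -- Conjugation by `d` in coordinate `i` multiplies the block on the left; conjugation in
  -- coordinate `j` multiplies it on the right.
  have hleft : ∀ (d : W ≃ₗ[D] W) (a : Module.End D W), 1 + blockEnd i j a ∈ S →
      1 + blockEnd i j ((d : W →ₗ[D] W) * a) ∈ S := by
    intro d a ha
    have := hS.conj_mem (hS.diag_mem i d) (blockDiag_mul_symm i d) ha
    convert this using 1
    rw [mul_add, mul_one, add_mul, blockDiag_mul_symm]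
    congr 1
    apply LinearMap.ext; intro x
    simp [Module.End.mul_apply, blockDiag_apply_of_ne hij.symm, blockDiag_single_self]
  have hright : ∀ (d : W ≃ₗ[D] W) (a : Module.End D W), 1 + blockEnd i j a ∈ S →
      1 + blockEnd i j (a * (d : W →ₗ[D] W)) ∈ S := by
    intro d a ha
    have := hS.conj_mem (hS.diag_mem j d.symm) (blockDiag_symm_mul j d) ha
    convert this using 1
    rw [mul_add, mul_one, add_mul, blockDiag_symm_mul]
    congr 1
    apply LinearMap.ext; intro x
    simp [Module.End.mul_apply, blockDiag_apply_self, blockDiag_single_of_ne hij]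
  have h0 : (1 : Module.End D (ι → W)) + blockEnd i j 0 ∈ S := by
    rw [blockEnd_zero, add_zero]; exact S.one_mem
  have hvec : ∀ w' : W, 1 + blockEnd i j (φ.smulRight w') ∈ S := by
    intro w'
    by_cases hw' : w' = 0
    · subst hw'
      rw [LinearMap.smulRight_zero]; exact h0
    obtain ⟨d, hd⟩ := exists_linearEquiv_apply_eq (D := D) hw hw'
    convert hleft d _ h using 4
    apply LinearMap.ext; intro x; simp [hd]
  have hall : ∀ (ψ : W →ₗ[D] D) (w' : W), 1 + blockEnd i j (ψ.smulRight w') ∈ S := by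
    intro ψ w'
    by_cases hψ : ψ = 0
    · subst hψ
      rw [LinearMap.zero_smulRight]; exact h0
    obtain ⟨d, c, hd⟩ := exists_linearEquiv_dual_comp_eq hφ hψ
    -- The scalar relating `ψ ∘ d` to `φ` is absorbed into the vector.
    convert hright d.symm _ (hvec (c • w')) using 4
    apply LinearMap.ext; intro x
    have := hd (d.symm x)
    rw [LinearEquiv.apply_symm_apply] at this
    simp [this, mul_smul]
  refine Or.inr fun a => ?_
  have hsum : ∀ (s : Finset (Fin (Module.finrank D W))) (f : _ → Module.End D W),
      (∀ k, 1 + blockEnd i j (f k) ∈ S) → 1 + blockEnd i j (∑ k ∈ s, f k) ∈ S := by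
    intro s f hf
    induction s using Finset.induction_on with
    | empty => simpa using h0
    | insert k s hk ih =>
      rw [Finset.sum_insert hk, ← one_add_blockEnd_mul hij]
      exact S.mul_mem (hf k) ih
  -- Every endomorphism is a sum of rank-one maps, and transvections in one position multiply by
  -- adding blocks.
  let B := Module.finBasis D W
  have ha : a = ∑ k, (B.coord k).smulRight (a (B k)) := by
    apply LinearMap.ext; intro x
    conv_lhs => rw [← B.sum_repr x, map_sum]
    simp [LinearMap.sum_apply]
  rw [ha]
  exact hsum _ _ fun k => hall _ _

end Transvections

/-! ### Conjugates and commutators of transformations `1 + v ⊗ u`. -/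

section RankOne

variable {D V : Type*} [DivisionRing D] [AddCommGroup V] [Module D V]

theorem one_add_smulRight_apply (v : V →ₗ[D] D) (u x : V) :
    (1 + v.smulRight u : Module.End D V) x = x + v x • u := rfl

theorem conj_one_add_smulRight {A B : Module.End D V} (hAB : A * B = 1) (v : V →ₗ[D] D) (u : V) :
    A * (1 + v.smulRight u) * B = 1 + (v ∘ₗ B).smulRight (A u) := by
  rw [mul_add, mul_one, add_mul, hAB]
  congr 1
  apply LinearMap.ext; intro x
  simp

theorem one_add_smulRight_mul_inv {v : V →ₗ[D] D} {u : V} (h : 1 + v u ≠ 0) :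
    (1 + v.smulRight u) * (1 + v.smulRight (-(1 + v u)⁻¹ • u) : Module.End D V) = 1 := by
  apply LinearMap.ext; intro x
  simp only [Module.End.mul_apply, one_add_smulRight_apply, map_add, map_smul,
    Module.End.one_apply]
  have h1 : u + v u • u = (1 + v u) • u := by rw [add_smul, one_smul]
  rw [h1, neg_smul, ← mul_smul, inv_mul_cancel₀ h]
  simp

/-- If `A` fixes the functional `v`, then `1 + v ⊗ u` and its conjugate by `A` differ by a
transvection along `A u - u`. -/
theorem split_left {S : Submonoid (Module.End D V)}
    (hS : ∀ {A B : Module.End D V}, A ∈ S → A * B = 1 → B ∈ S) {v : V →ₗ[D] D} {u : V}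
    (h : 1 + v u ≠ 0) (hm : 1 + v.smulRight u ∈ S) {A B : Module.End D V} (hA : A ∈ S)
    (hAB : A * B = 1) (hv : v ∘ₗ B = v) :
    1 + v.smulRight ((1 + v u)⁻¹ • (A u - u)) ∈ S := by
  have h1 := S.mul_mem (S.mul_mem hA hm) (hS hA hAB)
  rw [conj_one_add_smulRight hAB, hv] at h1
  have h2 := hS hm (one_add_smulRight_mul_inv h)
  -- The commutator of `A` with `1 + v ⊗ u`: both factors have functional `v`, so the product does
  -- too.
  convert S.mul_mem h1 h2 using 1
  apply LinearMap.ext; intro x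
  simp only [Module.End.mul_apply, one_add_smulRight_apply, map_add, map_smul]
  generalize hc : (1 + v u)⁻¹ = c
  have h3 : c • A u + c • v u • A u = A u := by
    rw [← mul_smul, ← add_smul]
    nth_rw 1 [← mul_one c]
    rw [← mul_add, ← hc, inv_mul_cancel₀ h, one_smul]
  have h4 : v x • A u = v x • (c • A u + c • v u • A u) := by rw [h3]
  rw [h4]
  simp only [smul_sub, smul_add, neg_smul, smul_neg]
  abel

/-- If `A` fixes the vector `u`, then `1 + v ⊗ u` and its conjugate by `A` differ by a
transvection along `u`. -/
theorem split_right {S : Submonoid (Module.End D V)}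
    (hS : ∀ {A B : Module.End D V}, A ∈ S → A * B = 1 → B ∈ S) {v : V →ₗ[D] D} {u : V}
    (h : 1 + v u ≠ 0) (hm : 1 + v.smulRight u ∈ S) {A B : Module.End D V} (hA : A ∈ S)
    (hAB : A * B = 1) (hu : A u = u) :
    1 + (v ∘ₗ B - v).smulRight ((1 + v u)⁻¹ • u) ∈ S := by
  have h1 := S.mul_mem (S.mul_mem hA hm) (hS hA hAB)
  rw [conj_one_add_smulRight hAB, hu] at h1
  have h2 := hS hm (one_add_smulRight_mul_inv h)
  convert S.mul_mem h2 h1 using 1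
  apply LinearMap.ext; intro x
  simp only [Module.End.mul_apply, one_add_smulRight_apply, map_add, map_smul,
    LinearMap.comp_apply, LinearMap.sub_apply]
  generalize hc : (1 + v u)⁻¹ = c
  have h3 : c • u + v u • c • u = u := by
    rw [← mul_smul, ← add_smul]
    nth_rw 1 [← one_mul c]
    rw [← add_mul, ← hc, mul_inv_cancel₀ h, one_smul]
  have h4 : v (B x) • u = v (B x) • (c • u + v u • c • u) := by rw [h3]
  rw [smul_add, h4]
  simp only [sub_smul, smul_add, neg_smul, smul_neg]
  abel

end RankOne

end LatticeNets

namespace LatticeNets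

/-! ### Extraction of transvections by two commutators. -/

section Extraction

variable {D W ι : Type*} [DivisionRing D] [AddCommGroup W] [Module D W] [Module.Finite D W]
  [DecidableEq ι] {S : Submonoid (Module.End D (ι → W))}

-- If every `d` fixed `φ`, then `φ (d w - w) = 0`; but some `d'` carries `w` to the nonzero vector
-- `d w - w`, so `φ w = 0` as well.
omit [Module.Finite D W] in
theorem exists_dual_comp_ne (hW : ∀ w : W, w ≠ 0 → ∃ d : W ≃ₗ[D] W, d w ≠ w)
    {φ : W →ₗ[D] D} (hφ : φ ≠ 0) : ∃ d : W ≃ₗ[D] W, φ ∘ₗ (d : W →ₗ[D] W) ≠ φ := by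
  by_contra! h
  obtain ⟨w, hw⟩ : ∃ w, φ w ≠ 0 := by
    by_contra! h0
    exact hφ (LinearMap.ext h0)
  have hw0 : w ≠ 0 := by rintro rfl; simp at hw
  obtain ⟨d, hd⟩ := hW w hw0
  obtain ⟨d', hd'⟩ := exists_linearEquiv_apply_eq (D := D) hw0 (sub_ne_zero.2 hd)
  have h1 := LinearMap.congr_fun (h d) w
  have h2 := LinearMap.congr_fun (h d') w
  simp only [LinearMap.comp_apply, LinearEquiv.coe_coe] at h1 h2
  rw [hd', map_sub, h1, sub_self] at h2
  exact hw h2.symm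

omit [Module.Finite D W] in
theorem comp_blockDiag_sub (v : (ι → W) →ₗ[D] D) (j : ι) (d : W ≃ₗ[D] W) :
    v ∘ₗ blockDiag j d - v =
      (v ∘ₗ LinearMap.single D (fun _ => W) j ∘ₗ (d : W →ₗ[D] W) -
        v ∘ₗ LinearMap.single D (fun _ => W) j) ∘ₗ LinearMap.proj j := by
  apply LinearMap.ext; intro x
  simp [blockDiag, Pi.single_sub]

omit [Module.Finite D W] in
theorem comp_blockDiag_symm_eq {v : (ι → W) →ₗ[D] D} {i : ι} {d : W ≃ₗ[D] W}
    (h : ∀ w, v (Pi.single i (d w)) = v (Pi.single i w)) : v ∘ₗ blockDiag i d.symm = v := by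
  rw [← sub_eq_zero, comp_blockDiag_sub]
  apply LinearMap.ext; intro x
  have := h (d.symm (x i))
  rw [LinearEquiv.apply_symm_apply] at this
  simp [this]

omit [Module.Finite D W] in
theorem blockDiag_sub_apply (i : ι) (d : W ≃ₗ[D] W) (u : ι → W) :
    blockDiag i d u - u = Pi.single i (d (u i) - u i) := by
  simp [blockDiag]

/-- Extraction of transvections from `1 + v ⊗ u`, when some automorphism of the `i`-th summand
fixes the component of `v` and moves the component of `u`. -/
theorem transvectionRel_of_move_vector (hS : ContainsDiagonal S)
    (hW : ∀ w : W, w ≠ 0 → ∃ d : W ≃ₗ[D] W, d w ≠ w) {v : (ι → W) →ₗ[D] D} {u : ι → W}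
    (h1 : 1 + v u ≠ 0) (hm : 1 + v.smulRight u ∈ S) {i j : ι} (hij : i ≠ j) (d : W ≃ₗ[D] W)
    (hd : ∀ w, v (Pi.single i (d w)) = v (Pi.single i w)) (hdu : d (u i) ≠ u i)
    (hj : ∃ w, v (Pi.single j w) ≠ 0) : transvectionRel S i j := by
  -- The first commutator confines the vector to coordinate `i`; a second one, with an automorphism
  -- of summand `j`, will confine the functional to coordinate `j`.
  have h2 := split_left hS.inv_mem h1 hm (hS.diag_mem i d) (blockDiag_mul_symm i d)
    (comp_blockDiag_symm_eq hd)
  rw [blockDiag_sub_apply, ← Pi.single_smul] at h2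
  set w := (1 + v u)⁻¹ • (d (u i) - u i) with hw
  have hw0 : w ≠ 0 := smul_ne_zero (inv_ne_zero h1) (sub_ne_zero.2 hdu)
  have hvw : v (Pi.single i w) = 0 := by
    rw [hw, Pi.single_smul, map_smul, Pi.single_sub, map_sub, hd]; simp
  have hφ : v ∘ₗ LinearMap.single D (fun _ => W) j ≠ 0 := by
    obtain ⟨z, hz⟩ := hj
    exact fun h => hz (LinearMap.congr_fun h z)
  obtain ⟨d', hd'⟩ := exists_dual_comp_ne hW hφ
  have h3 := split_right hS.inv_mem (by rw [hvw]; simp) h2 (hS.diag_mem j d'.symm)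
    (by simpa using blockDiag_mul_symm j d'.symm) (blockDiag_single_of_ne hij _ _)
  rw [comp_blockDiag_sub, hvw, add_zero, inv_one, one_smul] at h3
  refine transvectionRel_of_rankOne hS hij (sub_ne_zero.2 hd') hw0 ?_
  convert h3 using 2
  apply LinearMap.ext; intro x
  simp [Pi.single_smul]

/-- Extraction of transvections from `1 + v ⊗ u`, when some automorphism of the `j`-th summand
fixes the component of `u` and moves the component of `v`. -/
theorem transvectionRel_of_move_dual (hS : ContainsDiagonal S)
    (hW : ∀ w : W, w ≠ 0 → ∃ d : W ≃ₗ[D] W, d w ≠ w) {v : (ι → W) →ₗ[D] D} {u : ι → W}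
    (h1 : 1 + v u ≠ 0) (hm : 1 + v.smulRight u ∈ S) {i j : ι} (hij : i ≠ j) (d : W ≃ₗ[D] W)
    (hd : d (u j) = u j) (hdv : ∃ w, v (Pi.single j (d w)) ≠ v (Pi.single j w))
    (hi : u i ≠ 0) : transvectionRel S i j := by
  have hfix : blockDiag j d.symm u = u := by
    rw [← sub_eq_zero, blockDiag_sub_apply, LinearEquiv.symm_apply_eq _ |>.2 hd.symm]
    simp
  -- The dual order: first the functional is confined to coordinate `j`, then the vector to
  -- coordinate `i`.
  have h2 := split_right hS.inv_mem h1 hm (hS.diag_mem j d.symm)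
    (by simpa using blockDiag_mul_symm j d.symm) hfix
  rw [comp_blockDiag_sub] at h2
  set φ := v ∘ₗ LinearMap.single D (fun _ => W) j ∘ₗ (d : W →ₗ[D] W) -
        v ∘ₗ LinearMap.single D (fun _ => W) j with hφ
  have hφ0 : φ ≠ 0 := by
    obtain ⟨z, hz⟩ := hdv
    intro h
    have := LinearMap.congr_fun h z
    rw [hφ] at this
    exact hz (sub_eq_zero.1 this)
  set w := (1 + v u)⁻¹ • u with hw
  have hφw : (φ ∘ₗ LinearMap.proj j) w = 0 := by
    rw [hw, map_smul]
    simp [hφ, hd]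
  have hwi : w i ≠ 0 := smul_ne_zero (inv_ne_zero h1) hi
  obtain ⟨d', hd'⟩ := hW _ hwi
  have h3 := split_left hS.inv_mem (by rw [hφw]; simp) h2 (hS.diag_mem i d')
    (blockDiag_mul_symm i d') (comp_blockDiag_symm_eq fun z => by simp [hij.symm])
  rw [blockDiag_sub_apply, hφw, add_zero, inv_one, one_smul] at h3
  refine transvectionRel_of_rankOne hS hij hφ0 (sub_ne_zero.2 hd') ?_
  convert h3 using 2
  apply LinearMap.ext; intro x
  simp [← Pi.single_smul]

/-- The extraction theorem for summands of dimension at least two. -/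
theorem transvectionRel_of_exists_fixing (hS : ContainsDiagonal S)
    (hW : ∀ (φ : W →ₗ[D] D) (w : W), w ≠ 0 → ∃ d : W ≃ₗ[D] W, (∀ x, φ (d x) = φ x) ∧ d w ≠ w)
    {v : (ι → W) →ₗ[D] D} {u : ι → W} (h1 : 1 + v u ≠ 0) (hm : 1 + v.smulRight u ∈ S)
    {i j : ι} (hij : i ≠ j) (hi : u i ≠ 0) (hj : ∃ w, v (Pi.single j w) ≠ 0) :
    transvectionRel S i j := by
  obtain ⟨d, hd, hdu⟩ := hW (v ∘ₗ LinearMap.single D (fun _ => W) i) _ hi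
  exact transvectionRel_of_move_vector hS
    (fun w hw => (hW 0 w hw).imp fun d hd => hd.2) h1 hm hij d hd hdu hj

end Extraction

/-! ### Families of dilations and their conjugates. -/

section Dilations

variable {D V : Type*} [DivisionRing D] [AddCommGroup V] [Module D V]

/-- The family of all dilations with axis `ker v` and centre spanned by `u` belongs to `S`. -/
structure ContainsDilations (S : Submonoid (Module.End D V)) (v : V →ₗ[D] D) (u : V) : Prop where
  apply_eq_one : v u = 1
  mem : ∀ c : D, c ≠ -1 → 1 + v.smulRight (c • u) ∈ S

theorem ContainsDilations.conj {S : Submonoid (Module.End D V)} {v : V →ₗ[D] D} {u : V}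
    (h : ContainsDilations S v u) {A B : Module.End D V} (hA : A ∈ S) (hB : B ∈ S)
    (hAB : A * B = 1) (hBA : B * A = 1) : ContainsDilations S (v ∘ₗ B) (A u) where
  apply_eq_one := by
    rw [LinearMap.comp_apply, ← Module.End.mul_apply, hBA]; exact h.apply_eq_one
  mem c hc := by
    have := S.mul_mem (S.mul_mem hA (h.mem c hc)) hB
    rwa [conj_one_add_smulRight hAB, map_smul] at this

theorem one_add_smulRight_mul_eq_one {v : V →ₗ[D] D} {u : V} (h : v u = 1) {e : D} (he : e ≠ 0) :
    (1 + v.smulRight ((e - 1) • u)) * (1 + v.smulRight ((e⁻¹ - 1) • u) : Module.End D V) = 1 := by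
  apply LinearMap.ext; intro x
  simp only [Module.End.mul_apply, one_add_smulRight_apply, map_add, map_smul, h,
    Module.End.one_apply, one_smul, add_assoc]
  have h1 : u + (e - 1) • u = e • u := by rw [sub_smul, one_smul]; abel
  rw [h1, ← smul_add, ← mul_smul (e⁻¹ - 1), ← add_smul, sub_mul, inv_mul_cancel₀ he]
  simp

variable {W ι : Type*} [AddCommGroup W] [Module D W] [DecidableEq ι]
  {S : Submonoid (Module.End D (ι → W))}

/-- Conjugating the dilations of one coordinate line by a member of a family of dilations. -/
theorem ContainsDilations.exists_conj {v : (ι → W) →ₗ[D] D} {u : ι → W}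
    (h : ContainsDilations S v u) {β : W →ₗ[D] D} {w : W} {r : ι}
    (hr : ContainsDilations S (β ∘ₗ LinearMap.proj r) (Pi.single r w)) {e : D} (he : e ≠ 0) :
    ∃ (v' : (ι → W) →ₗ[D] D) (u' : ι → W), ContainsDilations S v' u' ∧
      (∀ k, β (u' k) = (if k = r then 1 else 0) + v (Pi.single r w) * (e - 1) * β (u k)) ∧
      ∀ k, v' (Pi.single k w) =
        (if k = r then 1 else 0) + v (Pi.single k w) * (e⁻¹ - 1) * β (u r) := by
  have hβ : β w = 1 := by simpa using hr.apply_eq_one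
  refine ⟨_, _, hr.conj (h.mem (e - 1) fun h0 => he ?_) (h.mem (e⁻¹ - 1) fun h0 => he ?_)
    (one_add_smulRight_mul_eq_one h.apply_eq_one he)
    (by simpa using one_add_smulRight_mul_eq_one h.apply_eq_one (inv_ne_zero he)), fun k => ?_,
    fun k => ?_⟩
  · simpa using h0
  · simpa using h0
  · rw [one_add_smulRight_apply]
    by_cases hk : k = r
    · subst hk; simp [hβ, mul_assoc]
    · simp [hk, mul_assoc]
  · rw [LinearMap.comp_apply, one_add_smulRight_apply]
    by_cases hk : k = r
    · subst hk; simp [hβ, mul_assoc]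
    · simp [hk, Ne.symm hk, mul_assoc]

theorem one_add_mul_mul_eq_zero_iff {x y z : D} (hx : x ≠ 0) (hz : z ≠ 0) :
    1 + x * y * z = 0 ↔ y = -(z * x)⁻¹ := by
  constructor
  · intro h
    have h1 : x * y * z = -1 := by rw [eq_neg_iff_add_eq_zero, add_comm]; exact h
    rw [mul_inv_rev, eq_neg_iff_add_eq_zero]
    have : y = x⁻¹ * (x * y * z) * z⁻¹ := by
      rw [mul_assoc x, inv_mul_cancel_left₀ hx, mul_inv_cancel_right₀ hz]
    rw [this, h1]; simp
  · rintro rfl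
    rw [mul_inv_rev]
    simp [hx, hz]

end Dilations

/-! ### Extraction when the summands are lines. -/

section LineExtraction

variable {D W ι : Type*} [DivisionRing D] [AddCommGroup W] [Module D W] [Module.Finite D W]
  [DecidableEq ι] {S : Submonoid (Module.End D (ι → W))}

/-- Since `v` vanishes on summand `i`, any automorphism of that summand preserves `v`, and one
moving `u i` can be used freely. The scalar `c` selects a nontrivial member of the family. -/
theorem ContainsDilations.transvectionRel_of_dual_eq_zero (hS : ContainsDiagonal S)
    (hW : ∀ w : W, w ≠ 0 → ∃ d : W ≃ₗ[D] W, d w ≠ w) {c : D} (hc0 : c ≠ 0) (hc : c ≠ -1)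
    {v : (ι → W) →ₗ[D] D} {u : ι → W} (h : ContainsDilations S v u) {i j : ι} (hij : i ≠ j)
    (hvi : ∀ w, v (Pi.single i w) = 0) (hi : u i ≠ 0) (hj : ∃ w, v (Pi.single j w) ≠ 0) :
    transvectionRel S i j := by
  have hi' : (c • u) i ≠ 0 := smul_ne_zero hc0 hi
  obtain ⟨d, hd⟩ := hW _ hi'
  refine transvectionRel_of_move_vector hS hW ?_ (h.mem c hc) hij d (fun w => ?_) hd hj
  · rw [map_smul, h.apply_eq_one, smul_eq_mul, mul_one]
    intro h0; exact hc (eq_neg_of_add_eq_zero_right h0)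
  · rw [hvi, hvi]

theorem ContainsDilations.transvectionRel_of_vector_eq_zero (hS : ContainsDiagonal S)
    (hW : ∀ w : W, w ≠ 0 → ∃ d : W ≃ₗ[D] W, d w ≠ w) {c : D} (hc0 : c ≠ 0) (hc : c ≠ -1)
    {v : (ι → W) →ₗ[D] D} {u : ι → W} (h : ContainsDilations S v u) {i j : ι} (hij : i ≠ j)
    (huj : u j = 0) (hi : u i ≠ 0) (hj : ∃ w, v (Pi.single j w) ≠ 0) :
    transvectionRel S i j := by
  have hφ : v ∘ₗ LinearMap.single D (fun _ => W) j ≠ 0 := by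
    obtain ⟨z, hz⟩ := hj
    exact fun h => hz (LinearMap.congr_fun h z)
  obtain ⟨d, hd⟩ := exists_dual_comp_ne hW hφ
  refine transvectionRel_of_move_dual hS hW ?_ (h.mem c hc) hij d (by simp [huj]) ?_
    (smul_ne_zero hc0 hi)
  · rw [map_smul, h.apply_eq_one, smul_eq_mul, mul_one]
    intro h0; exact hc (eq_neg_of_add_eq_zero_right h0)
  · by_contra! h0
    exact hd (LinearMap.ext h0)

/-- The scalars needed for summands of dimension one. -/
structure HasGoodScalars (D : Type*) [DivisionRing D] : Prop where
  half : (2 : D) ≠ 0 → ∃ e : D, e ≠ 0 ∧ e ≠ 1 ∧ e ≠ -1 ∧ e * e ≠ -1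
  one : ∃ e : D, e ≠ 0 ∧ e ≠ 1 ∧ e * e - e + 1 ≠ 0 ∧ 2 * (e * e) - 3 * e + 2 ≠ 0

variable {β : W →ₗ[D] D} {w : W}

omit [Module.Finite D W] in
theorem exists_linearEquiv_apply_ne (hD : HasGoodScalars D) :
    ∀ w : W, w ≠ 0 → ∃ d : W ≃ₗ[D] W, d w ≠ w := by
  intro w hw
  obtain ⟨e, he0, he1, -⟩ := hD.one
  obtain ⟨d, hd⟩ := exists_linearEquiv_apply_eq (D := D) hw (smul_ne_zero he0 hw)
  refine ⟨d, fun h => he1 ?_⟩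
  rw [h] at hd
  by_contra h1
  have : (e - 1) • w = 0 := by rw [sub_smul, one_smul, ← hd, sub_self]
  exact smul_ne_zero (sub_ne_zero.2 h1) hw this

/-- Extraction at a coordinate `r` where the product of the components of `u` and `v` is none of
`0`, `1` and `1 / 2`. -/
theorem ContainsDilations.transvectionRel_of_generic (hD : HasGoodScalars D)
    (hS : ContainsDiagonal S) (hw : ∀ x : W, x = β x • w)
    (hr : ∀ r : ι, ContainsDilations S (β ∘ₗ LinearMap.proj r) (Pi.single r w))
    {v : (ι → W) →ₗ[D] D} {u : ι → W} (h : ContainsDilations S v u) {r : ι}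
    (h0 : β (u r) * v (Pi.single r w) ≠ 0) (h1 : β (u r) * v (Pi.single r w) ≠ 1)
    (h2 : 2 * (β (u r) * v (Pi.single r w)) ≠ 1) :
    (∀ j, j ≠ r → v (Pi.single j w) ≠ 0 → transvectionRel S r j) ∧
      ∀ i, i ≠ r → β (u i) ≠ 0 → transvectionRel S i r := by
  have hW := exists_linearEquiv_apply_ne (W := W) hD
  obtain ⟨c, hc0, hc⟩ : ∃ c : D, c ≠ 0 ∧ c ≠ -1 := by
    obtain ⟨e, he0, he1, -⟩ := hD.one
    refine ⟨e - 1, sub_ne_zero.2 he1, fun h => he0 ?_⟩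
    simpa using h
  have hU : β (u r) ≠ 0 := left_ne_zero_of_mul h0
  have hV : v (Pi.single r w) ≠ 0 := right_ne_zero_of_mul h0
  set a := β (u r) * v (Pi.single r w) with ha
  have hβ : ∀ x, β x ≠ 0 → x ≠ 0 := by rintro x hx rfl; simp at hx
  -- The factor `e = 1 - a⁻¹` solves `1 + v_r (e - 1) u_r = 0`. Conjugating with `e` kills the new
  -- `u_r`, and with `e⁻¹` the new `v_r`. The other component survives unless `e = e⁻¹`, that is `e
  -- = 1` (impossible) or `e = -1` (meaning `2 a = 1`).
  have he : (1 - a⁻¹ : D) ≠ 0 := by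
    intro h3; apply h1; rw [sub_eq_zero] at h3; exact inv_eq_one.1 h3.symm
  have hne : 1 + v (Pi.single r w) * ((1 - a⁻¹)⁻¹ - 1) * β (u r) ≠ 0 := by
    rw [Ne, one_add_mul_mul_eq_zero_iff hV hU, ← ha]
    intro h3
    have h4 : (1 - a⁻¹)⁻¹ = 1 - a⁻¹ := by
      rw [sub_eq_iff_eq_add] at h3; rw [h3]; abel
    have h6 := mul_inv_cancel₀ he
    rw [h4, mul_self_eq_one_iff] at h6
    clear h4
    rcases h6 with h4 | h4
    · simp [h0] at h4
    · apply h2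
      have h5 : a⁻¹ = 2 := by
        rw [sub_eq_iff_eq_add] at h4
        rw [eq_comm, neg_add_eq_iff_eq_add] at h4
        rw [h4]; norm_num
      rw [← h5, inv_mul_cancel₀ h0]
  have hz : 1 + v (Pi.single r w) * (1 - a⁻¹ - 1) * β (u r) = 0 := by
    rw [one_add_mul_mul_eq_zero_iff hV hU, ← ha]; abel
  have he' : (1 - a⁻¹ : D) - 1 ≠ 0 := by simp [h0]
  have he'' : (1 - a⁻¹ : D)⁻¹ - 1 ≠ 0 := by
    rw [sub_ne_zero]; intro h3; rw [inv_eq_one] at h3; simp [h0] at h3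
  constructor
  · intro j hj hvj
    obtain ⟨v', u', h', hu', hv'⟩ := h.exists_conj (hr r) (inv_ne_zero he)
    refine h'.transvectionRel_of_dual_eq_zero hS hW hc0 hc hj.symm ?_ (hβ _ ?_) ⟨w, ?_⟩
    · intro x
      rw [hw x, Pi.single_smul, map_smul, hv', inv_inv, if_pos rfl, hz, smul_zero]
    · rw [hu', if_pos rfl]; exact hne
    · rw [hv', if_neg hj, zero_add, inv_inv]
      exact mul_ne_zero (mul_ne_zero hvj he') hU
  · intro i hi hui
    obtain ⟨v', u', h', hu', hv'⟩ := h.exists_conj (hr r) he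
    refine h'.transvectionRel_of_vector_eq_zero hS hW hc0 hc hi ?_ (hβ _ ?_) ⟨w, ?_⟩
    · rw [hw (u' r), hu', if_pos rfl, hz, zero_smul]
    · rw [hu', if_neg hi, zero_add]
      exact mul_ne_zero (mul_ne_zero hV he') hui
    · rw [hv', if_pos rfl]; exact hne

theorem inv_mul_mul_generic {x y : D} (hx : x ≠ 0) (h0 : y ≠ 0) (h1 : y ≠ 1) (h2 : 2 * y ≠ 1) :
    x⁻¹ * y * x ≠ 0 ∧ x⁻¹ * y * x ≠ 1 ∧ 2 * (x⁻¹ * y * x) ≠ 1 := by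
  refine ⟨by simp [hx, h0], fun h => h1 ?_, fun h => h2 ?_⟩
  · have : x * (x⁻¹ * y * x) * x⁻¹ = y := by
      rw [← mul_assoc, mul_inv_cancel_left₀ hx, mul_inv_cancel_right₀ hx]
    rw [← this, h]; simp [hx]
  · have : x * (2 * (x⁻¹ * y * x)) * x⁻¹ = 2 * y := by
      rw [two_mul, two_mul, mul_add, add_mul, ← mul_assoc, mul_inv_cancel_left₀ hx,
        mul_inv_cancel_right₀ hx]
    rw [← this, h]; simp [hx]

/-- Extraction at a coordinate `r` where the product of the components of `u` and `v` is
`1 / 2`. -/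
theorem ContainsDilations.transvectionRel_of_half (hD : HasGoodScalars D)
    (hS : ContainsDiagonal S) (hw : ∀ x : W, x = β x • w)
    (hr : ∀ r : ι, ContainsDilations S (β ∘ₗ LinearMap.proj r) (Pi.single r w))
    {v : (ι → W) →ₗ[D] D} {u : ι → W} (h : ContainsDilations S v u) {r : ι}
    (h2 : 2 * (β (u r) * v (Pi.single r w)) = 1) :
    (∀ j, j ≠ r → v (Pi.single j w) ≠ 0 → transvectionRel S r j) ∧
      ∀ i, i ≠ r → β (u i) ≠ 0 → transvectionRel S i r := by
  have h20 : (2 : D) ≠ 0 := left_ne_zero_of_mul (h2.trans_ne one_ne_zero)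
  -- Conjugating with `e` replaces the product `1/2` by a conjugate of `(2 + e + e⁻¹)/4`. This is
  -- `0`, `1` or `1/2` only if `e = -1`, `e = 1` or `e * e = -1` respectively, which `half` rules
  -- out.
  obtain ⟨e, he0, he1, hem1, hee⟩ := hD.half h20
  have h0 : β (u r) * v (Pi.single r w) ≠ 0 := right_ne_zero_of_mul (h2.trans_ne one_ne_zero)
  have hU : β (u r) ≠ 0 := left_ne_zero_of_mul h0
  have hV : v (Pi.single r w) ≠ 0 := right_ne_zero_of_mul h0
  obtain ⟨v', u', h', hu', hv'⟩ := h.exists_conj (hr r) he0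
  set U := β (u r) with hUdef
  have hVU : v (Pi.single r w) = U⁻¹ * 2⁻¹ := by
    rw [eq_inv_mul_iff_mul_eq₀ hU]; exact eq_inv_of_mul_eq_one_right h2
  have c2 : ∀ x : D, 2⁻¹ * x = x * 2⁻¹ := fun x =>
    ((Commute.ofNat_left 2 x).inv_left₀).eq
  have key : ∀ f : D, 1 + v (Pi.single r w) * (f - 1) * U = U⁻¹ * (2⁻¹ * (f + 1)) * U := by
    intro f
    have h3 : (2 : D)⁻¹ * (f + 1) = 1 + 2⁻¹ * (f - 1) := by
      have : (2 : D)⁻¹ * 2 = 1 := inv_mul_cancel₀ h20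
      have h4 : f + 1 = 2 + (f - 1) := by rw [← one_add_one_eq_two]; abel
      rw [h4, mul_add, this]
    rw [h3, hVU, mul_add, add_mul, mul_one, inv_mul_cancel₀ hU]
    simp only [mul_assoc]
  have hprod : β (u' r) * v' (Pi.single r w) =
      U⁻¹ * (2⁻¹ * (e + 1) * (2⁻¹ * (e⁻¹ + 1))) * U := by
    rw [hu', hv', if_pos rfl, key, key]
    simp only [mul_assoc, mul_inv_cancel_left₀ hU]
  have hX : (2 : D)⁻¹ * (e + 1) * (2⁻¹ * (e⁻¹ + 1)) = 2⁻¹ * 2⁻¹ * (2 + e + e⁻¹) := by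
    have h3 : (e + 1) * (e⁻¹ + 1) = 2 + e + e⁻¹ := by
      rw [add_mul, mul_add, mul_inv_cancel₀ he0, ← one_add_one_eq_two]; simp; abel
    rw [← h3, mul_assoc, ← mul_assoc (e + 1), ← c2 (e + 1)]
    simp only [mul_assoc]
  have g0 : (2 : D)⁻¹ * (e + 1) * (2⁻¹ * (e⁻¹ + 1)) ≠ 0 := by
    have a1 : e + 1 ≠ 0 := fun h => hem1 (eq_neg_of_add_eq_zero_left h)
    have a2 : e⁻¹ + 1 ≠ 0 := by
      intro h; apply hem1
      have := eq_neg_of_add_eq_zero_left h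
      rw [inv_eq_iff_eq_inv] at this
      rw [this]; simp [inv_neg]
    exact mul_ne_zero (mul_ne_zero (inv_ne_zero h20) a1) (mul_ne_zero (inv_ne_zero h20) a2)
  have g1 : (2 : D)⁻¹ * (e + 1) * (2⁻¹ * (e⁻¹ + 1)) ≠ 1 := by
    rw [hX]
    intro h3
    have h4 : 2 + e + e⁻¹ = 2 * 2 := by
      rw [mul_assoc, inv_mul_eq_iff_eq_mul₀ h20, inv_mul_eq_iff_eq_mul₀ h20] at h3
      simpa using h3
    apply he1
    have h5 : (e - 1) * (e - 1) = (2 + e + e⁻¹ - 2 * 2) * e := by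
      rw [sub_mul (2 + e + e⁻¹), add_mul, add_mul, inv_mul_cancel₀ he0,
        ← one_add_one_eq_two]
      noncomm_ring
    rw [h4, sub_self, zero_mul, mul_self_eq_zero, sub_eq_zero] at h5
    exact h5
  have g2 : 2 * ((2 : D)⁻¹ * (e + 1) * (2⁻¹ * (e⁻¹ + 1))) ≠ 1 := by
    rw [hX, mul_assoc, mul_inv_cancel_left₀ h20, Ne, inv_mul_eq_iff_eq_mul₀ h20]
    intro h3
    apply hee
    have h5 : e * e + 1 = (2 + e + e⁻¹ - 2 * 1) * e := by
      rw [sub_mul, add_mul, add_mul, inv_mul_cancel₀ he0]; noncomm_ring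
    rw [h3, sub_self, zero_mul] at h5
    exact eq_neg_of_add_eq_zero_left h5
  obtain ⟨k0, k1, k2⟩ := inv_mul_mul_generic hU g0 g1 g2
  rw [← hprod] at k0 k1 k2
  obtain ⟨p, q⟩ := h'.transvectionRel_of_generic hD hS hw hr k0 k1 k2
  refine ⟨fun j hj hvj => p j hj ?_, fun i hi hui => q i hi ?_⟩
  · rw [hv', if_neg hj, zero_add]
    refine mul_ne_zero (mul_ne_zero hvj (sub_ne_zero.2 ?_)) hU
    rwa [Ne, inv_eq_one]
  · rw [hu', if_neg hi, zero_add]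
    exact mul_ne_zero (mul_ne_zero hV (sub_ne_zero.2 he1)) hui

/-- Extraction for two coordinates where the products of the components of `u` and `v` are both
`1`. -/
theorem ContainsDilations.transvectionRel_of_one (hD : HasGoodScalars D)
    (hS : ContainsDiagonal S) (hw : ∀ x : W, x = β x • w)
    (hr : ∀ r : ι, ContainsDilations S (β ∘ₗ LinearMap.proj r) (Pi.single r w))
    {v : (ι → W) →ₗ[D] D} {u : ι → W} (h : ContainsDilations S v u) {i j : ι} (hij : i ≠ j)
    (hi : β (u i) * v (Pi.single i w) = 1) (hj : β (u j) * v (Pi.single j w) = 1) :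
    transvectionRel S i j := by
  -- Conjugating at `i` with `e` turns the product at `j` into a conjugate of `2 - e - e⁻¹`. The
  -- conditions in `one` say that this is not `0`, `1` or `1/2`, so the generic case applies at `j`;
  -- the new `u_i` is conjugate to `e`, hence nonzero.
  obtain ⟨e, he0, he1, hq1, hq2⟩ := hD.one
  have hU : β (u i) ≠ 0 := left_ne_zero_of_mul (hi.trans_ne one_ne_zero)
  obtain ⟨v', u', h', hu', hv'⟩ := h.exists_conj (hr i) he0
  have hVU : v (Pi.single i w) = (β (u i))⁻¹ := eq_inv_of_mul_eq_one_right hi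
  set U := β (u i) with hUdef
  have hprod : β (u' j) * v' (Pi.single j w) = U⁻¹ * ((e - 1) * (e⁻¹ - 1)) * U := by
    rw [hu', hv', if_neg hij.symm, zero_add, zero_add, hVU]
    have : U⁻¹ * (e - 1) * β (u j) * (v (Pi.single j w) * (e⁻¹ - 1) * U) =
        U⁻¹ * (e - 1) * (β (u j) * v (Pi.single j w)) * (e⁻¹ - 1) * U := by
      simp only [mul_assoc]
    rw [this, hj, mul_one]
    simp only [mul_assoc]
  have hX : (e - 1) * (e⁻¹ - 1) = 2 - e - e⁻¹ := by
    rw [sub_mul, mul_sub, mul_inv_cancel₀ he0, ← one_add_one_eq_two]; simp; abel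
  have g0 : (e - 1) * (e⁻¹ - 1) ≠ 0 := by
    refine mul_ne_zero (sub_ne_zero.2 he1) (sub_ne_zero.2 ?_)
    rwa [Ne, inv_eq_one]
  have g1 : (e - 1) * (e⁻¹ - 1) ≠ 1 := by
    rw [hX]; intro h3
    apply hq1
    have : e * e - e + 1 = (1 - (2 - e - e⁻¹)) * e := by
      simp only [sub_mul, inv_mul_cancel₀ he0]; noncomm_ring
    rw [this, h3, sub_self, zero_mul]
  have g2 : 2 * ((e - 1) * (e⁻¹ - 1)) ≠ 1 := by
    rw [hX]; intro h3
    apply hq2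
    have : 2 * (e * e) - 3 * e + 2 = (1 - 2 * (2 - e - e⁻¹)) * e := by
      have t3 : (3 : D) = 1 + 1 + 1 := by norm_num
      simp only [sub_mul, mul_sub, mul_assoc, inv_mul_cancel₀ he0]
      rw [t3, ← one_add_one_eq_two]
      noncomm_ring
    rw [this, h3, sub_self, zero_mul]
  obtain ⟨k0, k1, k2⟩ := inv_mul_mul_generic hU g0 g1 g2
  rw [← hprod] at k0 k1 k2
  refine (h'.transvectionRel_of_generic hD hS hw hr k0 k1 k2).2 i hij ?_
  rw [hu', if_pos rfl, hVU]
  have : 1 + U⁻¹ * (e - 1) * U = U⁻¹ * e * U := by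
    rw [mul_sub, sub_mul, mul_one, inv_mul_cancel₀ hU]; abel
  rw [← hUdef, this]
  simp [hU, he0]

/-- The extraction theorem for summands of dimension one. -/
theorem ContainsDilations.transvectionRel (hD : HasGoodScalars D)
    (hS : ContainsDiagonal S) (hw : ∀ x : W, x = β x • w)
    (hr : ∀ r : ι, ContainsDilations S (β ∘ₗ LinearMap.proj r) (Pi.single r w))
    {v : (ι → W) →ₗ[D] D} {u : ι → W} (h : ContainsDilations S v u) {i j : ι} (hij : i ≠ j)
    (hi : u i ≠ 0) (hj : ∃ x, v (Pi.single j x) ≠ 0) :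
    transvectionRel S i j := by
  have hW := exists_linearEquiv_apply_ne (W := W) hD
  obtain ⟨c, hc0, hc⟩ : ∃ c : D, c ≠ 0 ∧ c ≠ -1 := by
    obtain ⟨e, he0, he1, -⟩ := hD.one
    refine ⟨e - 1, sub_ne_zero.2 he1, fun h => he0 ?_⟩
    simpa using h
  have hv : ∀ k x, v (Pi.single k x) = β x * v (Pi.single k w) := by
    intro k x
    conv_lhs => rw [hw x, Pi.single_smul, map_smul, smul_eq_mul]
  have hβ : ∀ x, β x ≠ 0 ↔ x ≠ 0 := by
    refine fun x => ⟨by rintro hx rfl; simp at hx, fun hx h0 => hx ?_⟩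
    rw [hw x, h0, zero_smul]
  have hVj : v (Pi.single j w) ≠ 0 := by
    obtain ⟨x, hx⟩ := hj
    rw [hv] at hx
    exact right_ne_zero_of_mul hx
  have hUi := (hβ _).2 hi
  by_cases hVi : v (Pi.single i w) = 0
  · exact h.transvectionRel_of_dual_eq_zero hS hW hc0 hc hij
      (fun x => by rw [hv, hVi, mul_zero]) hi hj
  by_cases huj : u j = 0
  · exact h.transvectionRel_of_vector_eq_zero hS hW hc0 hc hij huj hi hj
  have hUj := (hβ _).2 huj
  by_cases hi2 : 2 * (β (u i) * v (Pi.single i w)) = 1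
  · exact (h.transvectionRel_of_half hD hS hw hr hi2).1 j hij.symm hVj
  by_cases hj2 : 2 * (β (u j) * v (Pi.single j w)) = 1
  · exact (h.transvectionRel_of_half hD hS hw hr hj2).2 i hij hUi
  by_cases hi1 : β (u i) * v (Pi.single i w) = 1
  · by_cases hj1 : β (u j) * v (Pi.single j w) = 1
    · exact h.transvectionRel_of_one hD hS hw hr hij hi1 hj1
    · exact (h.transvectionRel_of_generic hD hS hw hr (mul_ne_zero hUj hVj) hj1 hj2).2 i hij hUi
  · exact (h.transvectionRel_of_generic hD hS hw hr (mul_ne_zero hUi hVi) hi1 hi2).1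
      j hij.symm hVj

end LineExtraction

end LatticeNets

namespace LatticeNets

/-! ### Admissible summands and the general extraction theorem. -/

section Admissible

variable {D W ι : Type*} [DivisionRing D] [AddCommGroup W] [Module D W] [DecidableEq ι]
  {S : Submonoid (Module.End D (ι → W))}

/-- The conditions on the dimension of the summands and on the scalars. -/
def IsAdmissible (D W : Type*) [DivisionRing D] [AddCommGroup W] [Module D W] : Prop :=
  (2 ≤ Module.finrank D W ∧ (Module.finrank D W = 2 → ∃ c : D, c ≠ 0 ∧ c ≠ 1)) ∨
    (Module.finrank D W = 1 ∧ HasGoodScalars D)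

/-- If `ker φ` has a vector `z` outside the line of `w`, a transvection along `z` moves `w`.
Otherwise `ker φ` lies in the line of `w`, so `dim W = 2` and `ker φ` equals that line; then a map
scaling `w` by some `c ≠ 0, 1` works. The field with two elements fails exactly here. -/
theorem exists_linearEquiv_fixing_dual [Module.Finite D W] (h2 : 2 ≤ Module.finrank D W)
    (hD : Module.finrank D W = 2 → ∃ c : D, c ≠ 0 ∧ c ≠ 1) (φ : W →ₗ[D] D) (w : W)
    (hw : w ≠ 0) : ∃ d : W ≃ₗ[D] W, (∀ x, φ (d x) = φ x) ∧ d w ≠ w := by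
  by_cases hz : ∃ z ∈ LinearMap.ker φ, z ∉ Submodule.span D {w}
  · obtain ⟨z, hz, hzw⟩ := hz
    have hwz : w ∉ Submodule.span D {z} := by
      rw [Submodule.mem_span_singleton]
      rintro ⟨a, rfl⟩
      have ha : a ≠ 0 := by rintro rfl; simp at hw
      apply hzw
      rw [Submodule.mem_span_singleton]
      exact ⟨a⁻¹, by rw [smul_smul, inv_mul_cancel₀ ha, one_smul]⟩
    obtain ⟨ψ, hψw, hψ⟩ := Submodule.exists_le_ker_of_notMem hwz
    have hψz : ψ z = 0 := hψ (Submodule.mem_span_singleton_self z)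
    refine ⟨LinearEquiv.dilatransvection (f := ψ) (v := z) (by rw [hψz]; simp), fun x => ?_, ?_⟩
    · rw [LinearEquiv.dilatransvection.apply, map_add, map_smul, LinearMap.mem_ker.1 hz]; simp
    · rw [LinearEquiv.dilatransvection.apply]
      have : z ≠ 0 := by rintro rfl; simp at hzw
      simpa using ⟨hψw, this⟩
  · push Not at hz
    have hle : LinearMap.ker φ ≤ Submodule.span D {w} := hz
    have h1 := LinearMap.finrank_range_add_finrank_ker φ
    have h3 : Module.finrank D (LinearMap.range φ) ≤ 1 := by
      simpa using Submodule.finrank_le (LinearMap.range φ)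
    have h4 := Submodule.finrank_mono hle
    rw [finrank_span_singleton hw] at h4
    obtain ⟨c, hc0, hc1⟩ := hD (by omega)
    have hker : LinearMap.ker φ = Submodule.span D {w} :=
      Submodule.eq_of_le_of_finrank_eq hle (by rw [finrank_span_singleton hw]; omega)
    have hφw : φ w = 0 := by
      rw [← LinearMap.mem_ker, hker]; exact Submodule.mem_span_singleton_self w
    obtain ⟨ψ, hψw, -⟩ := Submodule.exists_le_ker_of_notMem (K := D) (p := ⊥) (v := w) (by simpa)
    set χ : W →ₗ[D] D := ψ.smulRight ((ψ w)⁻¹ * (c - 1)) with hχ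
    have hχw : χ w = c - 1 := by simp [hχ, hψw]
    refine ⟨LinearEquiv.dilatransvection (f := χ) (v := w) (by rw [hχw]; simpa), fun x => ?_, ?_⟩
    · rw [LinearEquiv.dilatransvection.apply, map_add, map_smul, hφw]; simp
    · rw [LinearEquiv.dilatransvection.apply, hχw]
      simpa [sub_eq_zero] using ⟨hc1, hw⟩

theorem IsAdmissible.exists_dual_vector [Module.Finite D W] (h : IsAdmissible D W) {z : W}
    (hz : z ≠ 0) : ∃ (φ : W →ₗ[D] D) (w : W), w ≠ 0 ∧ φ z ≠ 0 ∧ 1 + φ w ≠ 0 := by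
  obtain ⟨φ, hφz, -⟩ := Submodule.exists_le_ker_of_notMem (K := D) (p := ⊥) (v := z) (by simpa)
  rcases h with ⟨h2, -⟩ | ⟨-, hD⟩
  · have h1 := LinearMap.finrank_range_add_finrank_ker φ
    have h3 : Module.finrank D (LinearMap.range φ) ≤ 1 := by
      simpa using Submodule.finrank_le (LinearMap.range φ)
    have h4 : LinearMap.ker φ ≠ ⊥ := by
      intro h0; rw [h0, finrank_bot] at h1; omega
    obtain ⟨w, hw, hw0⟩ := Submodule.exists_mem_ne_zero_of_ne_bot h4
    exact ⟨φ, w, hw0, hφz, by rw [LinearMap.mem_ker.1 hw]; simp⟩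
  · obtain ⟨e, he0, he1, -⟩ := hD.one
    -- This multiple of `z` makes `1 + φ w` equal to `e`.
    refine ⟨φ, ((e - 1) * (φ z)⁻¹) • z, smul_ne_zero (mul_ne_zero (sub_ne_zero.2 he1)
      (inv_ne_zero hφz)) hz, hφz, ?_⟩
    simpa [hφz] using he0

theorem blockDiag_dilatransvection {φ : W →ₗ[D] D} {w : W} (h : IsUnit (1 + φ w)) (k : ι) :
    blockDiag k (LinearEquiv.dilatransvection h) =
      1 + (φ ∘ₗ LinearMap.proj k).smulRight (Pi.single k w) := by
  apply LinearMap.ext; intro x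
  simp [blockDiag, LinearMap.transvection.apply, Pi.single_smul]

/-- The extraction theorem: conjugates of block diagonal transformations of rank one decompose
into transvections. -/
theorem transvectionRel_of_conj [Module.Finite D W] (hW : IsAdmissible D W)
    (hS : ContainsDiagonal S) {A B : Module.End D (ι → W)} (hA : A ∈ S) (hAB : A * B = 1)
    (hBA : B * A = 1) (k : ι) {φ : W →ₗ[D] D} {w : W} (h : 1 + φ w ≠ 0) {i j : ι} (hij : i ≠ j)
    (hi : A (Pi.single k w) i ≠ 0) (hj : ∃ x, φ (B (Pi.single j x) k) ≠ 0) :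
    transvectionRel S i j := by
  rcases hW with ⟨h2, hD⟩ | ⟨h1, hD⟩
  · have hm := hS.conj_mem hA hAB (hS.diag_mem k (LinearEquiv.dilatransvection h.isUnit))
    rw [blockDiag_dilatransvection, conj_one_add_smulRight hAB] at hm
    refine transvectionRel_of_exists_fixing hS (exists_linearEquiv_fixing_dual h2 hD) ?_ hm hij hi
      hj
    rw [LinearMap.comp_apply, ← Module.End.mul_apply, hBA]
    simpa using h
  · have hw0 : w ≠ 0 := by rintro rfl; simp at hi
    have hspan : ∀ x : W, ∃ c : D, c • w = x :=
      (finrank_eq_one_iff_of_nonzero' w hw0).1 h1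
    have hφw : φ w ≠ 0 := by
      intro h0
      obtain ⟨x, hx⟩ := hj
      obtain ⟨c, hc⟩ := hspan (B (Pi.single j x) k)
      rw [← hc, map_smul, h0] at hx
      simp at hx
    -- Normalising `φ` to `β w = 1` identifies the line `W` with `D`, so every coordinate carries
    -- its full family of dilations.
    set β : W →ₗ[D] D := φ.smulRight (φ w)⁻¹ with hβ
    have hβw : β w = 1 := by simp [hβ, hφw]
    have hw : ∀ x : W, x = β x • w := by
      intro x
      obtain ⟨c, rfl⟩ := hspan x
      rw [map_smul, hβw, smul_eq_mul, mul_one]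
    have hr : ∀ r : ι, ContainsDilations S (β ∘ₗ LinearMap.proj r) (Pi.single r w) := by
      intro r
      refine ⟨by simp [hβw], fun c hc => ?_⟩
      have hu : 1 + β (c • w) ≠ 0 := by
        rw [map_smul, hβw, smul_eq_mul, mul_one]
        intro h0; exact hc (eq_neg_of_add_eq_zero_right h0)
      have := hS.diag_mem r (LinearEquiv.dilatransvection hu.isUnit)
      rwa [blockDiag_dilatransvection, Pi.single_smul] at this
    refine ((hr k).conj hA (hS.inv_mem hA hAB) hAB hBA).transvectionRel hD hS hw hr hij hi ?_
    obtain ⟨x, hx⟩ := hj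
    exact ⟨x, mul_ne_zero hx (inv_ne_zero hφw)⟩

end Admissible

/-! ### Coordinate subspaces and their images. -/

section CoordSub

variable {D W ι : Type*} [DivisionRing D] [AddCommGroup W] [Module D W]

/-- The sum of the summands of `ι → W` with indices in `A`. -/
def coordSub (D W : Type*) {ι : Type*} [DivisionRing D] [AddCommGroup W] [Module D W]
    (A : Set ι) : Submodule D (ι → W) where
  carrier := {x | ∀ i, i ∉ A → x i = 0}
  add_mem' hx hy i hi := by simp [hx i hi, hy i hi]
  zero_mem' i _ := rfl
  smul_mem' c x hx i hi := by simp [hx i hi]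

theorem coordSub_mono {A B : Set ι} (h : A ⊆ B) : coordSub D W A ≤ coordSub D W B :=
  fun _ hx i hi => hx i fun h' => hi (h h')

variable [DecidableEq ι]

theorem single_mem_coordSub {A : Set ι} {i : ι} (hi : i ∈ A) (w : W) :
    Pi.single i w ∈ coordSub D W A := by
  intro j hj
  rw [Pi.single_eq_of_ne]
  rintro rfl; exact hj hi

theorem mem_of_single_mem_coordSub {A : Set ι} {i : ι} {w : W} (hw : w ≠ 0)
    (h : Pi.single i w ∈ coordSub D W A) : i ∈ A := by
  by_contra hi
  exact hw (by simpa using h i hi)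

variable [Fintype ι]

theorem mem_of_forall_single_mem {U : Submodule D (ι → W)} {x : ι → W}
    (h : ∀ i, x i ≠ 0 → Pi.single i (x i) ∈ U) : x ∈ U := by
  rw [← Finset.univ_sum_single x]
  refine U.sum_mem fun i _ => ?_
  by_cases hi : x i = 0
  · rw [hi, Pi.single_zero]; exact U.zero_mem
  · exact h i hi

/-- A single `x ∈ U` with `x k ≠ 0` forces the whole summand `k` into `U`: a functional nonzero at
`x k` yields one line of that summand, and any vector `w` off this line is reached with a functional
`ψ` that is nonzero on the line and kills `w`, so that `1 + ψ w = 1`. -/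
theorem exists_eq_coordSub [Module.Finite D W] (hW : IsAdmissible D W)
    {U : Submodule D (ι → W)} (hU : ∀ (k : ι) (φ : W →ₗ[D] D) (w : W), 1 + φ w ≠ 0 →
      ∀ x ∈ U, φ (x k) • (Pi.single k w : ι → W) ∈ U) : ∃ A, U = coordSub D W A := by
  have key : ∀ x ∈ U, ∀ k, x k ≠ 0 → ∀ w, (Pi.single k w : ι → W) ∈ U := by
    intro x hx k hk w
    obtain ⟨φ, w₀, hw₀, hφ, h1⟩ := hW.exists_dual_vector hk
    have h2 := hU k φ w₀ h1 x hx
    rw [Submodule.smul_mem_iff _ hφ] at h2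
    by_cases hw : w ∈ Submodule.span D {w₀}
    · obtain ⟨c, rfl⟩ := Submodule.mem_span_singleton.1 hw
      rw [Pi.single_smul]
      exact U.smul_mem c h2
    · have hw0 : w ≠ 0 := by rintro rfl; simp at hw
      have : w₀ ∉ Submodule.span D {w} := by
        rw [Submodule.mem_span_singleton]
        rintro ⟨a, rfl⟩
        have ha : a ≠ 0 := by rintro rfl; simp at hw₀
        apply hw
        rw [Submodule.mem_span_singleton]
        exact ⟨a⁻¹, by rw [smul_smul, inv_mul_cancel₀ ha, one_smul]⟩
      obtain ⟨ψ, hψ0, hψ⟩ := Submodule.exists_le_ker_of_notMem this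
      have hψw : ψ w = 0 := hψ (Submodule.mem_span_singleton_self w)
      have h3 := hU k ψ w (by rw [hψw]; simp) _ h2
      rwa [Pi.single_eq_same, Submodule.smul_mem_iff _ hψ0] at h3
  refine ⟨{k | ∃ x ∈ U, x k ≠ 0}, le_antisymm (fun x hx i hi => ?_) fun x hx => ?_⟩
  · by_contra h
    exact hi ⟨x, hx, h⟩
  · refine mem_of_forall_single_mem fun i hi => ?_
    have : i ∈ {k | ∃ x ∈ U, x k ≠ 0} := by
      by_contra h
      exact hi (hx i h)
    obtain ⟨y, hy, hyi⟩ := this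
    exact key y hy i hyi _

/-- Members of a group containing the block diagonal group map coordinate subspaces which are
closed under the attached preorder to coordinate subspaces. -/
theorem exists_map_coordSub_eq [Module.Finite D W] (hW : IsAdmissible D W)
    {S : Submonoid (Module.End D (ι → W))} (hS : ContainsDiagonal S) {A : Set ι}
    (hA : ∀ i j, transvectionRel S i j → j ∈ A → i ∈ A) {F : Module.End D (ι → W)} (hF : F ∈ S) :
    ∃ A', (coordSub D W A).map F = coordSub D W A' := by
  obtain ⟨G, hG, hFG, hGF⟩ := hS.exists_inv F hF
  refine exists_eq_coordSub hW ?_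
  rintro k φ w h1 _ ⟨y, hy, rfl⟩
  -- The preimage under `F` must lie in the subspace of `A`. A nonzero component at `i`, together
  -- with some `j ∈ A` contributing to `φ (F y k)`, is the input of the extraction theorem for the
  -- conjugate by `G` of a rank-one block, so `i` is related to `j`.
  refine ⟨φ (F y k) • G (Pi.single k w), ?_, ?_⟩
  · by_cases h0 : φ (F y k) = 0
    · rw [h0, zero_smul]; exact Submodule.zero_mem _
    have hj : ∃ j ∈ A, φ (F (Pi.single j (y j)) k) ≠ 0 := by
      by_contra! hj
      apply h0
      conv_lhs => rw [← Finset.univ_sum_single y]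
      rw [map_sum, Finset.sum_apply, map_sum]
      refine Finset.sum_eq_zero fun j _ => ?_
      by_cases hjA : j ∈ A
      · exact hj j hjA
      · rw [hy j hjA]; simp
    obtain ⟨j, hjA, hj⟩ := hj
    refine Submodule.smul_mem _ _ fun i hi => ?_
    by_contra hu
    have hij : i ≠ j := by rintro rfl; exact hi hjA
    exact hi (hA i j (transvectionRel_of_conj hW hS hG hGF hFG k h1 hij hu ⟨_, hj⟩) hjA)
  · rw [map_smul, ← Module.End.mul_apply, hFG]; rfl

end CoordSub

end LatticeNets

namespace LatticeNets

/-! ### Gaussian elimination with the available transvections. -/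

section Generation

variable {D W : Type*} [DivisionRing D] [AddCommGroup W] [Module D W] [Module.Finite D W]

/-- If `a` and `b` are jointly injective, then `a + c ∘ b` is injective for a suitable `c`. -/
theorem exists_injective_add_comp {X : Type*} [AddCommGroup X] [Module D X] (a : W →ₗ[D] W)
    (b : W →ₗ[D] X) (h : ∀ w, a w = 0 → b w = 0 → w = 0) :
    ∃ c : X →ₗ[D] W, Function.Injective (a + c ∘ₗ b) := by
  obtain ⟨C, hC⟩ := Submodule.exists_isCompl (LinearMap.range a)
  have hdim : Module.finrank D (LinearMap.ker a) = Module.finrank D C := by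
    have h1 := LinearMap.finrank_range_add_finrank_ker a
    have h2 := Submodule.finrank_add_eq_of_isCompl hC
    omega
  -- Here `b` is injective on `ker a`. Recovering `ker a` from `b` by a left inverse and sending it
  -- onto a complement of `range a` fills exactly what `a` loses.
  let θ := LinearEquiv.ofFinrankEq (LinearMap.ker a) C hdim
  obtain ⟨g, hg⟩ := LinearMap.exists_leftInverse_of_injective (b ∘ₗ (LinearMap.ker a).subtype)
    (by
      rw [LinearMap.ker_eq_bot']
      exact fun w hw => Subtype.ext (h w w.2 hw))
  refine ⟨C.subtype ∘ₗ (θ : LinearMap.ker a →ₗ[D] C) ∘ₗ g, ?_⟩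
  rw [injective_iff_map_eq_zero]
  intro w hw
  have hw' : a w = -((θ (g (b w)) : C) : W) := eq_neg_of_add_eq_zero_left hw
  have h0 : a w = 0 := by
    have h1 : a w ∈ LinearMap.range a ⊓ C :=
      ⟨⟨w, rfl⟩, by rw [hw']; exact C.neg_mem (θ (g (b w))).2⟩
    rwa [hC.inf_eq_bot] at h1
  have h2 : g (b w) = ⟨w, h0⟩ := LinearMap.congr_fun hg ⟨w, h0⟩
  rw [h0, h2, zero_eq_neg, Submodule.coe_eq_zero, LinearEquiv.map_eq_zero_iff] at hw'
  exact congrArg Subtype.val hw'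

variable {ι : Type*} [DecidableEq ι] {S : Submonoid (Module.End D (ι → W))}

omit [Module.Finite D W] in
theorem one_add_sum_row_mem {i : ι} {s : Finset ι} (hi : i ∉ s)
    (hs : ∀ j ∈ s, transvectionRel S i j) (a : ι → Module.End D W) :
    1 + ∑ j ∈ s, blockEnd i j (a j) ∈ S := by
  induction s using Finset.induction_on with
  | empty => simp [S.one_mem]
  | insert j s hj ih =>
    have hij : i ≠ j := fun h => hi (h ▸ Finset.mem_insert_self _ _)
    have h1 : 1 + blockEnd i j (a j) ∈ S :=
      (hs j (Finset.mem_insert_self _ _)).resolve_left hij _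
    have h2 := S.mul_mem h1
      (ih (fun h => hi (Finset.mem_insert_of_mem h)) fun k hk => hs k (Finset.mem_insert_of_mem hk))
    convert h2 using 1
    have h3 : blockEnd i j (a j) * ∑ k ∈ s, blockEnd i k (a k) = 0 := by
      rw [Finset.mul_sum]
      exact Finset.sum_eq_zero fun k _ => blockEnd_mul_blockEnd_of_ne _ _ hij.symm _ _
    rw [Finset.sum_insert hj, mul_add, mul_one, add_mul, h3, add_zero, one_mul, add_assoc]

omit [Module.Finite D W] in
theorem one_add_sum_column_mem {i : ι} {s : Finset ι} (hi : i ∉ s)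
    (hs : ∀ j ∈ s, transvectionRel S j i) (a : ι → Module.End D W) :
    1 + ∑ j ∈ s, blockEnd j i (a j) ∈ S := by
  induction s using Finset.induction_on with
  | empty => simp [S.one_mem]
  | insert j s hj ih =>
    have hij : i ≠ j := fun h => hi (h ▸ Finset.mem_insert_self _ _)
    have h1 : 1 + blockEnd j i (a j) ∈ S :=
      (hs j (Finset.mem_insert_self _ _)).resolve_left hij.symm _
    have h2 := S.mul_mem h1
      (ih (fun h => hi (Finset.mem_insert_of_mem h)) fun k hk => hs k (Finset.mem_insert_of_mem hk))
    convert h2 using 1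
    have h3 : blockEnd j i (a j) * ∑ k ∈ s, blockEnd k i (a k) = 0 := by
      rw [Finset.mul_sum]
      refine Finset.sum_eq_zero fun k hk => blockEnd_mul_blockEnd_of_ne _ _ ?_ _ _
      rintro rfl; exact hi (Finset.mem_insert_of_mem hk)
    rw [Finset.sum_insert hj, mul_add, mul_one, add_mul, h3, add_zero, one_mul, add_assoc]

omit [Module.Finite D W] in
theorem single_mem_principal (S : Submonoid (Module.End D (ι → W))) {i k : ι}
    (h : transvectionRel S i k) (w : W) :
    Pi.single i w ∈ coordSub D W {j | transvectionRel S j k} :=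
  single_mem_coordSub (A := {j | transvectionRel S j k}) h w

/-- The endomorphism `f` maps every principal coordinate subspace of the preorder of `S` to
itself. -/
def PreservesPrincipal (S : Submonoid (Module.End D (ι → W))) (f : Module.End D (ι → W)) : Prop :=
  ∀ k, ∀ x ∈ coordSub D W {j | transvectionRel S j k},
    f x ∈ coordSub D W {j | transvectionRel S j k}

omit [Module.Finite D W] in
theorem PreservesPrincipal.mul {f g : Module.End D (ι → W)} (hf : PreservesPrincipal S f)
    (hg : PreservesPrincipal S g) : PreservesPrincipal S (f * g) :=
  fun k x hx => hf k _ (hg k x hx)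

omit [Module.Finite D W] in
theorem PreservesPrincipal.one_add_sum {κ : Type*} (s : Finset κ) (i j : κ → ι)
    (a : κ → Module.End D W) (h : ∀ k ∈ s, transvectionRel S (i k) (j k)) :
    PreservesPrincipal S (1 + ∑ k ∈ s, blockEnd (i k) (j k) (a k)) := by
  intro l x hx
  rw [LinearMap.add_apply, LinearMap.sum_apply]
  refine Submodule.add_mem _ hx (Submodule.sum_mem _ fun k hk => ?_)
  rw [blockEnd_apply]
  by_cases hl : transvectionRel S (j k) l
  · exact single_mem_principal S ((h k hk).trans hl) _
  · rw [hx _ hl]; simp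

omit [Module.Finite D W] in
theorem PreservesPrincipal.blockDiag (i : ι) (d : W ≃ₗ[D] W) :
    PreservesPrincipal S (blockDiag i d) := by
  have := PreservesPrincipal.one_add_sum (S := S) {()} (fun _ => i) (fun _ => i)
    (fun _ => (d : W →ₗ[D] W) - 1) fun _ _ => Or.inl rfl
  simpa [LatticeNets.blockDiag] using this

variable [Fintype ι]

/-- Let `B` consist of the indices below `i` that lie in `I` or are not equivalent to `i`. By
injectivity and dimension, `f` maps the subspace of `B` onto itself. If the claim failed, `f
(Pi.single i w)` would lie there, hence so would `Pi.single i w`, although `i ∉ B`. -/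
theorem exists_component_ne_zero {f : Module.End D (ι → W)} (hf : PreservesPrincipal S f)
    (hinj : Function.Injective f) {I : Set ι}
    (hI : ∀ l ∈ I, ∀ w, f (Pi.single l w) = Pi.single l w) {i : ι} (hi : i ∉ I) {w : W}
    (hw : w ≠ 0) : ∃ j, j ∉ I ∧ transvectionRel S i j ∧ transvectionRel S j i ∧
      f (Pi.single i w) j ≠ 0 := by
  by_contra! hcon
  set B : Set ι := {j | transvectionRel S j i ∧ (j ∈ I ∨ ¬ transvectionRel S i j)} with hB
  have hmap : (coordSub D W B).map f ≤ coordSub D W B := by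
    rintro _ ⟨x, hx, rfl⟩
    rw [← Finset.univ_sum_single x, map_sum]
    refine Submodule.sum_mem _ fun j _ => ?_
    by_cases hj : j ∈ B
    · obtain ⟨hji, hj' | hj'⟩ := hj
      · rw [hI j hj']
        exact single_mem_coordSub (A := B) ⟨hji, Or.inl hj'⟩ _
      · refine coordSub_mono (A := {l | transvectionRel S l j}) (fun l hl => ?_)
          (hf j _ (single_mem_principal S (Or.inl rfl) _))
        exact ⟨transvectionRel.trans hl hji, Or.inr fun h => hj' (h.trans hl)⟩
    · rw [hx j hj]; simp
  have heq : (coordSub D W B).map f = coordSub D W B :=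
    Submodule.eq_of_le_of_finrank_eq hmap
      (LinearEquiv.finrank_eq (Submodule.equivMapOfInjective f hinj _)).symm
  have hmem : f (Pi.single i w) ∈ coordSub D W B := by
    intro j hj
    by_cases hji : transvectionRel S j i
    · have hjI : j ∉ I := fun h => hj ⟨hji, Or.inl h⟩
      have hij : transvectionRel S i j := by
        by_contra h; exact hj ⟨hji, Or.inr h⟩
      exact hcon j hjI hij hji
    · exact hf i _ (single_mem_principal S (Or.inl rfl) w) j hji
  rw [← heq] at hmem
  obtain ⟨y, hy, hyw⟩ := hmem
  rw [hinj hyw] at hy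
  exact (mem_of_single_mem_coordSub hw hy).2.elim hi fun h => h (Or.inl rfl)

/-- The automorphisms which preserve the coordinate subspaces closed under the preorder of `S`
belong to `S`: they are generated by transvections and block diagonal automorphisms. -/
theorem mem_of_preservesPrincipal (hS : ContainsDiagonal S) (n : ℕ) :
    ∀ (I : Finset ι), (Finset.univ \ I).card = n → ∀ f : Module.End D (ι → W),
      PreservesPrincipal S f → Function.Injective f →
      (∀ l ∈ I, ∀ w, f (Pi.single l w) = Pi.single l w) → f ∈ S := by
  induction n with
  | zero =>
    intro I hI f _ _ hfix
    have hI' : ∀ l, l ∈ I := fun l => by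
      have := Finset.card_eq_zero.1 hI
      by_contra h
      exact Finset.notMem_empty l (this ▸ Finset.mem_sdiff.2 ⟨Finset.mem_univ l, h⟩)
    have : f = 1 := by
      apply LinearMap.pi_ext
      intro l w
      exact hfix l (hI' l) w
    rw [this]; exact S.one_mem
  | succ n ih =>
    intro I hI f hf hinj hfix
    obtain ⟨i, hi⟩ : (Finset.univ \ I).Nonempty := by
      rw [← Finset.card_pos, hI]; omega
    have hiI : i ∉ I := (Finset.mem_sdiff.1 hi).2
    have hcard : (Finset.univ \ insert i I).card = n := by
      rw [Finset.sdiff_insert, Finset.card_erase_of_mem hi, hI]; rfl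
    have hinjS : ∀ s ∈ S, Function.Injective s := by
      intro s hs
      obtain ⟨t, -, -, ht⟩ := hS.exists_inv s hs
      exact Function.LeftInverse.injective (g := t) (LinearMap.congr_fun ht)
    -- It is enough to normalise column `i` by left multiplication without disturbing the columns in
    -- `I`.
    suffices h : ∃ s ∈ S, PreservesPrincipal S s ∧
        ∀ l ∈ insert i I, ∀ w, s (f (Pi.single l w)) = Pi.single l w by
      obtain ⟨s, hs, hsp, hsfix⟩ := h
      obtain ⟨t, ht, -, hts⟩ := hS.exists_inv s hs
      have h1 := ih _ hcard (s * f) (hsp.mul hf) ((hinjS s hs).comp hinj) hsfix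
      have h2 := S.mul_mem ht h1
      rwa [← mul_assoc, hts, one_mul] at h2
    classical
    -- `J` is the class of `i` without `i` and `I`. `T₁` adds the rows in `J` to row `i` to make the
    -- diagonal block invertible, `T₃` turns that block into the identity, and `T₂` clears the rest
    -- of column `i`. Omitting `I` from `J` keeps the summands in `I` fixed.
    set J : Finset ι := Finset.univ.filter
      fun j => j ≠ i ∧ j ∉ I ∧ transvectionRel S i j ∧ transvectionRel S j i with hJ
    have hiJ : i ∉ J := by simp [hJ]
    let E : W →ₗ[D] (ι → W) := LinearMap.single D (fun _ => W) i
    obtain ⟨c, hc⟩ := exists_injective_add_comp (LinearMap.proj i ∘ₗ f ∘ₗ E)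
      (LinearMap.pi (fun j : J => LinearMap.proj (j : ι) ∘ₗ f ∘ₗ E)) (by
        intro w h1 h2
        by_contra hw
        obtain ⟨j, hj1, hj2, hj3, hj4⟩ := exists_component_ne_zero hf hinj (I := I) hfix hiI hw
        by_cases hji : j = i
        · subst hji; exact hj4 h1
        · exact hj4 (congrFun h2 ⟨j, by simp [hJ, hji, hj2, hj3]; exact hj1⟩))
    let T₁ : Module.End D (ι → W) := 1 + ∑ j ∈ J, blockEnd i j
      (if h : j ∈ J then c ∘ₗ LinearMap.single D (fun _ : J => W) ⟨j, h⟩ else 0)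
    have hT₁ : T₁ ∈ S := one_add_sum_row_mem hiJ (fun j hj => (Finset.mem_filter.1 hj).2.2.2.1) _
    have hT₁p : PreservesPrincipal S T₁ := PreservesPrincipal.one_add_sum _ _ _ _
      fun j hj => (Finset.mem_filter.1 hj).2.2.2.1
    have hT₁i : ∀ w, T₁ (f (Pi.single i w)) i =
        (LinearMap.proj i ∘ₗ f ∘ₗ E +
          c ∘ₗ LinearMap.pi (fun j : J => LinearMap.proj (j : ι) ∘ₗ f ∘ₗ E)) w := by
      intro w
      simp only [T₁, LinearMap.add_apply, LinearMap.sum_apply, Module.End.one_apply, Pi.add_apply,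
        Finset.sum_apply, blockEnd_apply, Pi.single_eq_same]
      congr 1
      rw [LinearMap.comp_apply, ← Finset.univ_sum_single (LinearMap.pi _ w), map_sum,
        ← Finset.sum_coe_sort J]
      refine Finset.sum_congr rfl fun j _ => ?_
      rw [dif_pos j.2]; rfl
    have hT₁fix : ∀ l, l ∉ J → ∀ w, T₁ (Pi.single l w) = Pi.single l w := by
      intro l hl w
      simp only [T₁, LinearMap.add_apply, LinearMap.sum_apply, Module.End.one_apply, blockEnd_apply]
      rw [add_eq_left]
      refine Finset.sum_eq_zero fun j hj => ?_
      have hjl : j ≠ l := by rintro rfl; exact hl hj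
      rw [Pi.single_eq_of_ne hjl, map_zero, Pi.single_zero]
    let d := LinearEquiv.ofInjectiveEndo _ hc
    let T₃ : Module.End D (ι → W) := blockDiag i d.symm
    set K : Finset ι := Finset.univ.filter fun j => j ≠ i ∧ transvectionRel S j i with hK
    have hiK : i ∉ K := by simp [hK]
    let T₂ : Module.End D (ι → W) := 1 + ∑ j ∈ K, blockEnd j i
      (-(LinearMap.proj j ∘ₗ (T₃ * (T₁ * f)) ∘ₗ E))
    have hT₂ : T₂ ∈ S := one_add_sum_column_mem hiK (fun j hj => (Finset.mem_filter.1 hj).2.2) _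
    have hT₂p : PreservesPrincipal S T₂ := PreservesPrincipal.one_add_sum _ _ _ _
      fun j hj => (Finset.mem_filter.1 hj).2.2
    refine ⟨T₂ * (T₃ * T₁), S.mul_mem hT₂ (S.mul_mem (hS.diag_mem _ _) hT₁),
      hT₂p.mul ((PreservesPrincipal.blockDiag _ _).mul hT₁p), fun l hl w => ?_⟩
    rcases Finset.mem_insert.1 hl with rfl | hl
    · have hp := ((PreservesPrincipal.blockDiag (S := S) l d.symm).mul (hT₁p.mul hf)) l
        (Pi.single l w) (single_mem_principal S (Or.inl rfl) w)
      set y := (T₃ * (T₁ * f)) (Pi.single l w) with hy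
      have hyl : y l = w := by
        have h1 : y l = d.symm (T₁ (f (Pi.single l w)) l) := blockDiag_apply_self _ _ _
        rw [h1, LinearEquiv.symm_apply_eq, hT₁i]
        rfl
      change T₂ y = _
      ext k
      have hT₂k : T₂ y k = y k - if k ∈ K then y k else 0 := by
        simp only [T₂, LinearMap.add_apply, LinearMap.sum_apply, Module.End.one_apply, Pi.add_apply,
          Finset.sum_apply, blockEnd_apply, sub_eq_add_neg]
        congr 1
        have : ∀ j, (-(LinearMap.proj j ∘ₗ (T₃ * (T₁ * f)) ∘ₗ E) : W →ₗ[D] W) (y l) = - y j := by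
          intro j; rw [hyl]; rfl
        simp only [this]
        split_ifs with hk
        · rw [Finset.sum_eq_single k]
          · simp
          · intro j _ hj; rw [Pi.single_eq_of_ne hj.symm]
          · exact fun h => absurd hk h
        · rw [neg_zero]
          refine Finset.sum_eq_zero fun j hj => ?_
          rw [Pi.single_eq_of_ne]
          rintro rfl; exact hk hj
      rw [hT₂k]
      by_cases hk : k ∈ K
      · have : k ≠ l := (Finset.mem_filter.1 hk).2.1
        rw [if_pos hk, Pi.single_eq_of_ne this, sub_self]
      · rw [if_neg hk, sub_zero]
        by_cases hkl : k = l
        · subst hkl; rw [hyl, Pi.single_eq_same]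
        · rw [Pi.single_eq_of_ne hkl]
          exact hp k fun h => hk (by simp [hK, hkl]; exact h)
    · have hli : l ≠ i := fun h => hiI (h ▸ hl)
      have hlJ : l ∉ J := fun h => (Finset.mem_filter.1 h).2.2.1 hl
      have h3 : T₃ (Pi.single l w) = Pi.single l w := blockDiag_single_of_ne hli _ _
      rw [hfix l hl, Module.End.mul_apply, Module.End.mul_apply, hT₁fix l hlJ, h3]
      simp only [T₂, LinearMap.add_apply, LinearMap.sum_apply, Module.End.one_apply, blockEnd_apply]
      rw [add_eq_left]
      refine Finset.sum_eq_zero fun j hj => ?_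
      rw [Pi.single_eq_of_ne hli.symm, map_zero, Pi.single_zero]

end Generation

end LatticeNets

namespace LatticeNets

/-! ### Stabilisers of generated sublattices. -/

section LatticeGeneral

variable {L : Type*}

theorem mem_pointwiseStabilizer_latticeClosure [Lattice L] {s : Set L} {g : L ≃o L} :
    g ∈ pointwiseStabilizer (latticeClosure s) ↔ ∀ x ∈ s, g x = x := by
  rw [pointwiseStabilizer, mem_fixingSubgroup_iff]
  refine ⟨fun h x hx => h x (subset_latticeClosure hx), fun h x hx => ?_⟩
  exact latticeClosure_min (t := {x | g x = x}) h
    ⟨fun a (ha : g a = a) b (hb : g b = b) => by simp [ha, hb],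
      fun a (ha : g a = a) b (hb : g b = b) => by simp [ha, hb]⟩ hx

variable [CompleteLattice L] {n : ℕ}

theorem mem_diagonalSubgroup {e : Fin n → L} {g : L ≃o L} :
    g ∈ diagonalSubgroup e ↔ ∀ i, g (e i) = e i := by
  rw [diagonalSubgroup, mem_pointwiseStabilizer_latticeClosure, Set.forall_mem_range]

theorem mem_pointwiseStabilizer_associatedLattice {τ : Fin n → Fin n → L} {g : L ≃o L} :
    g ∈ pointwiseStabilizer (associatedLattice τ) ↔ ∀ i, g (⨆ j, τ i j) = ⨆ j, τ i j := by
  rw [associatedLattice, mem_pointwiseStabilizer_latticeClosure, Set.forall_mem_range]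

open Classical in
/-- The collection attached to a relation on the index set. -/
noncomputable def relCollection (e : Fin n → L) (r : Fin n → Fin n → Prop) (i j : Fin n) : L :=
  if r j i then e j else ⊥

end LatticeGeneral

/-! ### Summands of `W^n` and lattice automorphisms. -/

section Decomposition

variable {D W : Type*} [DivisionRing D] [AddCommGroup W] [Module D W] {n : ℕ}

/-- The summands of `Fin n → W`. -/
def lineSub (D W : Type*) [DivisionRing D] [AddCommGroup W] [Module D W] (i : Fin n) :
    Submodule D (Fin n → W) :=
  coordSub D W {i}

theorem iSup_lineSub (A : Set (Fin n)) : ⨆ i : A, lineSub D W (i : Fin n) = coordSub D W A := by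
  refine le_antisymm (iSup_le fun i => coordSub_mono (Set.singleton_subset_iff.2 i.2))
    fun x hx => mem_of_forall_single_mem fun i hi => ?_
  have hiA : i ∈ A := by
    by_contra h; exact hi (hx i h)
  exact le_iSup (fun i : A => lineSub D W (i : Fin n)) ⟨i, hiA⟩
    (single_mem_coordSub (Set.mem_singleton i) _)

theorem iSup_relCollection_lineSub (r : Fin n → Fin n → Prop) (i : Fin n) :
    ⨆ j, relCollection (lineSub D W) r i j = coordSub D W {j | r j i} := by
  rw [← iSup_lineSub, iSup_subtype]
  refine iSup_congr fun j => ?_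
  by_cases h : r j i
  · simp [relCollection, h]
  · simp [relCollection, h]

theorem apply_coordSub_of_mem_diagonal {h : Submodule D (Fin n → W) ≃o Submodule D (Fin n → W)}
    (hh : h ∈ diagonalSubgroup (lineSub D W)) (A : Set (Fin n)) :
    h (coordSub D W A) = coordSub D W A := by
  rw [← iSup_lineSub, OrderIso.map_iSup]
  exact iSup_congr fun i => mem_diagonalSubgroup.1 hh i

theorem iSupIndep_lineSub : iSupIndep (lineSub D W : Fin n → _) := by
  rw [iSupIndep_iff_finsetSum_eq_zero_imp_eq_zero]
  intro s v hv hs i hi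
  ext j
  by_cases hij : j = i
  · subst hij
    have h1 := congrFun hs j
    rw [Finset.sum_apply, Finset.sum_eq_single j] at h1
    · exact h1
    · intro k hk hkj
      exact hv k hk j fun h => hkj (Set.mem_singleton_iff.1 h).symm
    · exact fun h => absurd hi h
  · exact hv i hi j hij

variable [Module.Finite D W]

/-- Dimension is the height of `U` in the lattice, hence an order invariant. -/
theorem finrank_apply {V : Type*} [AddCommGroup V] [Module D V] [Module.Finite D V]
    (g : Submodule D V ≃o Submodule D V) (U : Submodule D V) :
    Module.finrank D (g U) = Module.finrank D U := by
  have h := Order.height_orderIso g U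
  rw [← Module.length_submodule, ← Module.length_submodule, Module.length_eq_finrank,
    Module.length_eq_finrank] at h
  exact_mod_cast h

/-- Every lattice automorphism agrees with a linear automorphism on the given summands. -/
theorem exists_linearEquiv_map_lineSub
    (g : Submodule D (Fin n → W) ≃o Submodule D (Fin n → W)) :
    ∃ f : (Fin n → W) ≃ₗ[D] (Fin n → W), ∀ i, (lineSub D W i).map (f : _ →ₗ[D] _) =
      g (lineSub D W i) := by
  have hrange : ∀ i : Fin n, lineSub D W i = LinearMap.range (LinearMap.single D (fun _ => W) i) := by
    intro i
    apply le_antisymm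
    · intro x hx
      refine ⟨x i, ?_⟩
      ext j
      by_cases hj : j = i
      · subst hj; simp
      · rw [LinearMap.single_apply, Pi.single_eq_of_ne hj, hx j hj]
    · rintro _ ⟨w, rfl⟩
      exact single_mem_coordSub (Set.mem_singleton i) w
  have hdim : ∀ i : Fin n, Module.finrank D W = Module.finrank D (g (lineSub D W i)) := by
    intro i
    rw [finrank_apply, hrange, LinearMap.finrank_range_of_inj
      (Pi.single_injective (M := fun _ => W) i)]
  -- Arbitrary isomorphisms onto the images are glued together; independence of the images makes the
  -- result injective.
  let θ : ∀ i : Fin n, W ≃ₗ[D] g (lineSub D W i) := fun i => LinearEquiv.ofFinrankEq _ _ (hdim i)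
  let F : Module.End D (Fin n → W) :=
    ∑ i, (g (lineSub D W i)).subtype ∘ₗ (θ i : W →ₗ[D] _) ∘ₗ LinearMap.proj i
  have hF : ∀ x, F x = ∑ i, (θ i (x i) : Fin n → W) := by
    intro x; simp [F, LinearMap.sum_apply]
  have hind : iSupIndep fun i : Fin n => g (lineSub D W i) :=
    (iSupIndep_map_orderIso_iff g).2 iSupIndep_lineSub
  rw [iSupIndep_iff_finsetSum_eq_zero_imp_eq_zero] at hind
  have hinj : Function.Injective F := by
    rw [injective_iff_map_eq_zero]
    intro x hx
    rw [hF] at hx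
    ext i
    have := hind Finset.univ _ (fun i _ => (θ i (x i)).2) hx i (Finset.mem_univ i)
    rw [Submodule.coe_eq_zero, LinearEquiv.map_eq_zero_iff] at this
    exact this
  refine ⟨LinearEquiv.ofInjectiveEndo F hinj, fun i => ?_⟩
  have hFs : ∀ w, F (Pi.single i w) = θ i w := by
    intro w
    rw [hF, Finset.sum_eq_single i]
    · simp
    · intro j _ hj; rw [Pi.single_eq_of_ne hj]; simp
    · simp
  apply le_antisymm
  · rintro _ ⟨x, hx, rfl⟩
    rw [SetLike.mem_coe, hrange] at hx
    obtain ⟨w, rfl⟩ := hx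
    change F (Pi.single i w) ∈ _
    rw [hFs]
    exact (θ i w).2
  · intro y hy
    refine ⟨Pi.single i ((θ i).symm ⟨y, hy⟩), single_mem_coordSub (Set.mem_singleton i) _, ?_⟩
    change F _ = y
    rw [hFs]; simp

end Decomposition

/-! ### The sandwich theorem for subspaces of `W^n`. -/

section Core

variable {D W : Type*} [DivisionRing D] [AddCommGroup W] [Module D W] {n : ℕ}

/-- The endomorphisms of `V` which are automorphisms inducing a member of `F`. -/
def linearPart {V : Type*} [AddCommGroup V] [Module D V]
    (F : Subgroup (Submodule D V ≃o Submodule D V)) : Submonoid (Module.End D V) where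
  carrier := {A | ∃ f : V ≃ₗ[D] V, Submodule.orderIsoMapComap f ∈ F ∧ (f : V →ₗ[D] V) = A}
  one_mem' := by
    refine ⟨LinearEquiv.refl D V, ?_, rfl⟩
    convert F.one_mem
    refine DFunLike.ext _ _ fun U => ?_
    rw [Submodule.orderIsoMapComap_apply]
    exact Submodule.map_id U
  mul_mem' := by
    rintro _ _ ⟨f, hf, rfl⟩ ⟨g, hg, rfl⟩
    refine ⟨g.trans f, ?_, rfl⟩
    convert F.mul_mem hf hg
    refine DFunLike.ext _ _ fun U => ?_
    rw [Submodule.orderIsoMapComap_apply]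
    exact Submodule.map_comp (g : V →ₗ[D] V) (f : V →ₗ[D] V) U

theorem orderIsoMapComap_mem_of_mem_linearPart {V : Type*} [AddCommGroup V] [Module D V]
    {F : Subgroup (Submodule D V ≃o Submodule D V)} {f : V ≃ₗ[D] V}
    (h : (f : V →ₗ[D] V) ∈ linearPart F) : Submodule.orderIsoMapComap f ∈ F := by
  obtain ⟨f', hf', h⟩ := h
  rwa [← LinearEquiv.toLinearMap_injective h]

variable {F : Subgroup (Submodule D (Fin n → W) ≃o Submodule D (Fin n → W))}

theorem blockDiag_mem_linearPart (hF : diagonalSubgroup (lineSub D W) ≤ F) (i : Fin n)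
    (d : W ≃ₗ[D] W) : blockDiag i d ∈ linearPart F := by
  have hle : ∀ (d : W ≃ₗ[D] W) (j : Fin n),
      (lineSub D W j).map (blockDiag i d) ≤ lineSub D W j := by
    rintro d j _ ⟨x, hx, rfl⟩ k hk
    by_cases hki : k = i
    · subst hki; rw [blockDiag_apply_self, hx k hk, map_zero]
    · rw [blockDiag_apply_of_ne hki, hx k hk]
  refine ⟨LinearEquiv.ofLinearMap _ _ (blockDiag_mul_symm i d) (blockDiag_symm_mul i d), hF ?_, rfl⟩
  rw [mem_diagonalSubgroup]
  intro j
  refine le_antisymm (hle d j) fun x hx => ⟨blockDiag i d.symm x, hle d.symm j ⟨x, hx, rfl⟩, ?_⟩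
  exact LinearMap.congr_fun (blockDiag_mul_symm i d) x

theorem containsDiagonal_linearPart (hF : diagonalSubgroup (lineSub D W) ≤ F) :
    ContainsDiagonal (linearPart F) where
  exists_inv := by
    rintro _ ⟨f, hf, rfl⟩
    refine ⟨(f.symm : _ →ₗ[D] _), ⟨f.symm, ?_, rfl⟩, ?_, ?_⟩
    · convert F.inv_mem hf
      rw [eq_inv_iff_mul_eq_one]
      refine DFunLike.ext _ _ fun U => ?_
      change ((U.map (f : (Fin n → W) →ₗ[D] (Fin n → W))).map
        (f.symm : (Fin n → W) →ₗ[D] (Fin n → W))) = U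
      rw [← Submodule.map_comp]
      simp
    · apply LinearMap.ext; intro x; simp
    · apply LinearMap.ext; intro x; simp
  diag_mem := blockDiag_mem_linearPart hF

/-- The image contains a vector with nonzero components at `i` and `j`; being a coordinate subspace,
it contains `Pi.single i w`. The transvection fixes that vector, so it already lies in the source.
-/
theorem mem_of_map_transvection {i j : Fin n} (hij : i ≠ j) [Nontrivial W] {B B' : Set (Fin n)}
    (hj : j ∈ B)
    (h : (coordSub D W B).map (1 + blockEnd i j (1 : Module.End D W)) = coordSub D W B') :
    i ∈ B := by
  obtain ⟨w, hw⟩ := exists_ne (0 : W)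
  have h1 : (Pi.single j w + Pi.single i w : Fin n → W) ∈ coordSub D W B' := by
    rw [← h]
    exact ⟨Pi.single j w, single_mem_coordSub hj w, by simp⟩
  have hi' : i ∈ B' := by
    by_contra h2
    have := h1 i h2
    simp [hij, hw] at this
  have h3 : (Pi.single i w : Fin n → W) ∈ coordSub D W B' := single_mem_coordSub hi' w
  rw [← h] at h3
  obtain ⟨y, hy, hyw⟩ := h3
  have hyi : y = Pi.single i w := by
    have h4 := LinearMap.congr_fun (one_add_blockEnd_mul hij (-1 : Module.End D W) 1) y
    rw [Module.End.mul_apply, hyw] at h4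
    simpa [hij, blockEnd_zero] using h4.symm
  rw [hyi] at hy
  exact mem_of_single_mem_coordSub hw hy

/-- The elementary transvection in position `(i, j)`. -/
def elementaryTransvection (D W : Type*) [DivisionRing D] [AddCommGroup W] [Module D W]
    {i j : Fin n} (hij : i ≠ j) : (Fin n → W) ≃ₗ[D] (Fin n → W) :=
  LinearEquiv.ofLinearMap (1 + blockEnd i j (1 : Module.End D W)) (1 + blockEnd i j (-1))
    ((one_add_blockEnd_mul hij _ _).trans (by rw [add_neg_cancel, blockEnd_zero, add_zero]; rfl))
    ((one_add_blockEnd_mul hij _ _).trans (by rw [neg_add_cancel, blockEnd_zero, add_zero]; rfl))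

theorem elementaryTransvection_mem_stabilizer {r : Fin n → Fin n → Prop}
    (htrans : ∀ i j k, r i j → r j k → r i k) {i j : Fin n} (hij : i ≠ j) (h : r i j) :
    Submodule.orderIsoMapComap (elementaryTransvection D W hij) ∈
      pointwiseStabilizer (associatedLattice (relCollection (lineSub D W) r)) := by
  rw [mem_pointwiseStabilizer_associatedLattice]
  intro k
  rw [iSup_relCollection_lineSub, Submodule.orderIsoMapComap_apply]
  have key : ∀ a : Module.End D W, ∀ x ∈ coordSub D W {j | r j k},
      (1 + blockEnd i j a : Module.End D (Fin n → W)) x ∈ coordSub D W {j | r j k} := by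
    intro a x hx
    refine Submodule.add_mem _ hx ?_
    rw [blockEnd_apply]
    by_cases hjk : r j k
    · exact single_mem_coordSub (A := {j | r j k}) (htrans _ _ _ h hjk) _
    · rw [hx j hjk]; simp
  apply le_antisymm
  · rintro _ ⟨x, hx, rfl⟩
    exact key 1 x hx
  · intro x hx
    exact ⟨_, key (-1) x hx, (elementaryTransvection D W hij).apply_symm_apply x⟩

variable [Module.Finite D W]

/-- Subtracting `x` from its image under a rank-one block diagonal map gives the invariance required
by `exists_eq_coordSub`. -/
theorem exists_eq_coordSub_of_fixed (hW : IsAdmissible D W) {U : Submodule D (Fin n → W)}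
    (hU : ∀ h ∈ diagonalSubgroup (lineSub D W), h U = U) : ∃ A, U = coordSub D W A := by
  refine exists_eq_coordSub hW fun k φ w h1 x hx => ?_
  obtain ⟨f, hf, hfe⟩ := blockDiag_mem_linearPart (le_refl _) k
    (LinearEquiv.dilatransvection h1.isUnit)
  have h2 := hU _ hf
  rw [Submodule.orderIsoMapComap_apply, hfe, blockDiag_dilatransvection] at h2
  have h3 : (1 + (φ ∘ₗ LinearMap.proj k).smulRight (Pi.single k w) :
      Module.End D (Fin n → W)) x ∈ U := by
    rw [← h2]; exact ⟨x, hx, rfl⟩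
  rw [one_add_smulRight_apply] at h3
  exact (U.add_mem_iff_right hx).1 h3

omit [Module.Finite D W] in
theorem IsAdmissible.nontrivial (hW : IsAdmissible D W) : Nontrivial W := by
  apply Module.nontrivial_of_finrank_pos (R := D)
  rcases hW with ⟨h, -⟩ | ⟨h, -⟩ <;> omega

/-- A member of an overgroup of the diagonal group is the product of a linear member and a member
of the diagonal group. -/
theorem exists_linear_mul_diagonal (hF : diagonalSubgroup (lineSub D W) ≤ F)
    (g : Submodule D (Fin n → W) ≃o Submodule D (Fin n → W)) :
    ∃ f : (Fin n → W) ≃ₗ[D] (Fin n → W), ∃ h ∈ diagonalSubgroup (lineSub D W),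
      g = Submodule.orderIsoMapComap f * h ∧ (Submodule.orderIsoMapComap f ∈ F ↔ g ∈ F) := by
  obtain ⟨f, hf⟩ := exists_linearEquiv_map_lineSub g
  have hh : (Submodule.orderIsoMapComap f)⁻¹ * g ∈ diagonalSubgroup (lineSub D W) := by
    rw [mem_diagonalSubgroup]
    intro i
    rw [RelIso.mul_apply, ← hf i, ← Submodule.orderIsoMapComap_apply, RelIso.inv_apply_self]
  refine ⟨f, _, hh, by simp, fun h => ?_, fun h => ?_⟩
  · simpa using F.mul_mem h (hF hh)
  · simpa using F.mul_mem h (F.inv_mem (hF hh))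

theorem exists_apply_coordSub_eq (hW : IsAdmissible D W)
    (hF : diagonalSubgroup (lineSub D W) ≤ F) {A : Set (Fin n)}
    (hA : ∀ i j, transvectionRel (linearPart F) i j → j ∈ A → i ∈ A)
    {g : Submodule D (Fin n → W) ≃o Submodule D (Fin n → W)} (hg : g ∈ F) :
    ∃ B, (∀ i j, transvectionRel (linearPart F) i j → j ∈ B → i ∈ B) ∧
      g (coordSub D W A) = coordSub D W B := by
  have := hW.nontrivial
  have hS := containsDiagonal_linearPart hF
  have key : ∀ g ∈ F, ∃ B, g (coordSub D W A) = coordSub D W B := by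
    intro g hg
    obtain ⟨f, h, hh, rfl, hf⟩ := exists_linear_mul_diagonal hF g
    rw [RelIso.mul_apply, apply_coordSub_of_mem_diagonal hh, Submodule.orderIsoMapComap_apply]
    exact exists_map_coordSub_eq hW hS hA ⟨f, hf.2 hg, rfl⟩
  obtain ⟨B, hB⟩ := key g hg
  refine ⟨B, fun i j hij hj => ?_, hB⟩
  by_cases h : i = j
  · rwa [h]
  -- Closure of `B`: the product `t * g` is also in `F`, so the transvection sends the subspace of
  -- `B` to a coordinate subspace.
  obtain ⟨t, ht, hte⟩ := hij.resolve_left h 1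
  obtain ⟨B', hB'⟩ := key _ (F.mul_mem ht hg)
  rw [RelIso.mul_apply, hB, Submodule.orderIsoMapComap_apply, hte] at hB'
  exact mem_of_map_transvection h hj hB'

/-- Removing the factor in `H`, which fixes all coordinate subspaces, leaves a linear map that
preserves the principal subspaces, and elimination puts it in `F`. -/
theorem stabilizer_le (hF : diagonalSubgroup (lineSub D W) ≤ F) :
    pointwiseStabilizer (associatedLattice
      (relCollection (lineSub D W) (transvectionRel (linearPart F)))) ≤ F := by
  intro g hg
  rw [mem_pointwiseStabilizer_associatedLattice] at hg
  obtain ⟨f, h, hh, rfl, hf⟩ := exists_linear_mul_diagonal hF g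
  rw [← hf]
  refine orderIsoMapComap_mem_of_mem_linearPart (mem_of_preservesPrincipal
    (containsDiagonal_linearPart hF) _ ∅ rfl _ (fun k x hx => ?_) f.injective (by simp))
  have h1 := hg k
  rw [iSup_relCollection_lineSub, RelIso.mul_apply, apply_coordSub_of_mem_diagonal hh,
    Submodule.orderIsoMapComap_apply] at h1
  rw [← h1]
  exact ⟨x, hx, rfl⟩

theorem le_normalizer (hW : IsAdmissible D W) (hF : diagonalSubgroup (lineSub D W) ≤ F) :
    F ≤ Subgroup.normalizer (pointwiseStabilizer (associatedLattice
      (relCollection (lineSub D W) (transvectionRel (linearPart F)))) : Set _) := by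
  set G := pointwiseStabilizer (associatedLattice
      (relCollection (lineSub D W) (transvectionRel (linearPart F)))) with hG
  have key : ∀ g ∈ F, ∀ h ∈ G, g * h * g⁻¹ ∈ G := by
    intro g hg h hh
    rw [hG, mem_pointwiseStabilizer_associatedLattice] at hh ⊢
    intro k
    obtain ⟨B, hB, hBe⟩ := exists_apply_coordSub_eq hW hF
      (A := {j | transvectionRel (linearPart F) j k}) (fun i j hij hj => hij.trans hj)
      (F.inv_mem hg)
    -- A closed index set is a union of principal ones, so elements fixing the principal subspaces
    -- fix its subspace too.
    have hfix : h (coordSub D W B) = coordSub D W B := by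
      have : coordSub D W B =
          ⨆ k : B, coordSub D W {j | transvectionRel (linearPart F) j (k : Fin n)} := by
        refine le_antisymm ?_ (iSup_le fun k => coordSub_mono fun j hj => hB j k hj k.2)
        rw [← iSup_lineSub]
        exact iSup_mono fun k => coordSub_mono (Set.singleton_subset_iff.2 (Or.inl rfl))
      rw [this, OrderIso.map_iSup]
      refine iSup_congr fun k => ?_
      rw [← iSup_relCollection_lineSub]
      exact hh k
    rw [iSup_relCollection_lineSub, RelIso.mul_apply, RelIso.mul_apply, hBe, hfix, ← hBe,
      RelIso.apply_inv_self]
  intro g hg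
  rw [Subgroup.mem_normalizer_iff]
  refine fun h => ⟨key g hg h, fun hh => ?_⟩
  have := key g⁻¹ (F.inv_mem hg) _ hh
  simpa [mul_assoc] using this

/-- The transvection `t` in position `(i, j)` normalises the stabiliser for `r'`, which contains
`H`. So `t` maps the principal subspace of `j` for `r'` to an `H`-fixed, hence coordinate, subspace,
and `i` must be below `j` for `r'`. Using this in both directions gives uniqueness. -/
theorem relation_le_of_normalizes (hW : IsAdmissible D W) {r r' : Fin n → Fin n → Prop}
    (htrans : ∀ i j k, r i j → r j k → r i k) (hrefl : ∀ i, r' i i)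
    (hle : pointwiseStabilizer (associatedLattice (relCollection (lineSub D W) r)) ≤ F)
    (hN : F ≤ Subgroup.normalizer
      (pointwiseStabilizer (associatedLattice (relCollection (lineSub D W) r')) : Set _))
    {i j : Fin n} (h : r i j) : r' i j := by
  have := hW.nontrivial
  by_cases hij : i = j
  · rw [hij]; exact hrefl j
  have ht := hN (hle (elementaryTransvection_mem_stabilizer (D := D) (W := W) htrans hij h))
  set t := Submodule.orderIsoMapComap (elementaryTransvection D W hij)
  obtain ⟨B, hB⟩ := exists_eq_coordSub_of_fixed hW (U := t (coordSub D W {l | r' l j})) (by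
    intro d hd
    have hd' : d ∈ pointwiseStabilizer (associatedLattice (relCollection (lineSub D W) r')) := by
      rw [mem_pointwiseStabilizer_associatedLattice]
      intro k
      rw [iSup_relCollection_lineSub]
      exact apply_coordSub_of_mem_diagonal hd _
    rw [Subgroup.mem_normalizer_iff''] at ht
    have h1 := (ht d).1 hd'
    rw [mem_pointwiseStabilizer_associatedLattice] at h1
    have h2 := h1 j
    rw [iSup_relCollection_lineSub] at h2
    have h3 := congrArg t h2
    rw [RelIso.mul_apply, RelIso.mul_apply, RelIso.apply_inv_self] at h3
    exact h3)
  exact mem_of_map_transvection (B := {l | r' l j}) hij (hrefl j) hB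

/-- The sandwich theorem for the automorphism group of the lattice of subspaces of `Fin n → W`. -/
theorem existsUnique_relation (hW : IsAdmissible D W)
    (hF : diagonalSubgroup (lineSub D W) ≤ F) :
    ∃! r : Fin n → Fin n → Prop, ((∀ i, r i i) ∧ ∀ i j k, r i j → r j k → r i k) ∧
      pointwiseStabilizer (associatedLattice (relCollection (lineSub D W) r)) ≤ F ∧
      F ≤ Subgroup.normalizer
        (pointwiseStabilizer (associatedLattice (relCollection (lineSub D W) r)) : Set _) := by
  refine ⟨transvectionRel (linearPart F), ⟨⟨fun i => Or.inl rfl, fun i j k => .trans⟩,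
    stabilizer_le hF, le_normalizer hW hF⟩, ?_⟩
  rintro r ⟨⟨hrefl, htrans⟩, hle, hN⟩
  ext i j
  exact ⟨relation_le_of_normalizes hW htrans (fun i => Or.inl rfl) hle (le_normalizer hW hF),
    relation_le_of_normalizes hW (fun i j k => .trans) hrefl (stabilizer_le hF) hN⟩

end Core

end LatticeNets

namespace LatticeNets

/-! ### Good scalars in division rings with more than five elements. -/

section Scalars

variable {D : Type*} [DivisionRing D]

/-- If `x * x = -1` in characteristic three, then `(x + 1)² = 2x = -x`, which differs from `-1`; so
`x + 1` serves instead. -/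
theorem exists_mul_self_ne_neg_one_of_three (h3 : (3 : D) = 0) {x : D} (hx0 : x ≠ 0) (hx1 : x ≠ 1)
    (hxm : x ≠ -1) : ∃ e : D, e ≠ 0 ∧ e ≠ 1 ∧ e ≠ -1 ∧ e * e ≠ -1 := by
  by_cases hx : x * x = -1
  · refine ⟨x + 1, fun h => hxm (eq_neg_of_add_eq_zero_left h), by simpa using hx0,
      fun h => hx1 ?_, fun h => hx1 ?_⟩
    · have : x = 3 * x - (x + 1 - -1) - (x + 1 - -1) + 3 + 1 := by
        have t3 : (3 : D) = 1 + 1 + 1 := by norm_num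
        rw [t3]; noncomm_ring
      rw [h, h3] at this
      simpa using this
    · have : x = 3 * x + 1 - ((x + 1) * (x + 1) - -1) + (x * x - -1) := by noncomm_ring
      rw [h, hx, h3] at this
      simpa using this
  · exact ⟨x, hx0, hx1, hxm, hx⟩

/-- Otherwise `x² = x + 1` for all `x ≠ 0, 1`. For `s` and `t` outside `{0, 1}` with `t ≠ s, s + 1`,
the relation at `s + t` gives `st + ts = 1`, the one at `st` gives `st = s + t`, and multiplying by
`s` gives `t = s + 1`, a contradiction. -/
theorem exists_mul_self_ne_add_one (h2 : (2 : D) = 0)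
    (hD : ∀ s : Finset D, s.card ≤ 5 → ∃ x, x ∉ s) :
    ∃ x : D, x ≠ 0 ∧ x ≠ 1 ∧ x * x ≠ x + 1 := by
  classical
  by_contra! hall
  have hadd : ∀ x : D, x + x = 0 := fun x => by rw [← two_mul, h2, zero_mul]
  obtain ⟨s, hs⟩ := hD {0, 1} (Finset.card_le_two.trans (by norm_num))
  obtain ⟨t, ht⟩ := hD {0, 1, s, s + 1} (Finset.card_le_four.trans (by norm_num))
  simp only [Finset.mem_insert, Finset.mem_singleton, not_or] at hs ht
  obtain ⟨hs0, hs1⟩ := hs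
  obtain ⟨ht0, ht1, hts, hts1⟩ := ht
  have es := hall s hs0 hs1
  have et := hall t ht0 ht1
  have hst0 : s + t ≠ 0 := by
    intro h; apply hts
    rw [← sub_zero t, ← h, sub_add_cancel_right, ← add_left_inj s, hadd]; simp
  have hst1 : s + t ≠ 1 := by
    intro h; apply hts1
    rw [← h, ← add_assoc, hadd, zero_add]
  have est := hall _ hst0 hst1
  have comm : s * t + t * s = 1 := by
    have : s * t + t * s = (s + t) * (s + t) - s * s - t * t := by noncomm_ring
    rw [this, est, es, et]
    have : s + t + 1 - (s + 1) - (t + 1) = 1 - (1 + 1) := by abel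
    rw [this, hadd, sub_zero]
  have hts' : t * s = 1 + s * t := by
    rw [← comm, add_right_comm, hadd, zero_add]
  have hp0 : s * t ≠ 0 := mul_ne_zero hs0 ht0
  have hp1 : s * t ≠ 1 := by
    intro h
    apply hts1
    have h1 : s * (s * t) = s * t + t := by rw [← mul_assoc, es, add_mul, one_mul]
    rw [h, mul_one] at h1
    rw [h1, add_right_comm, hadd, zero_add]
  have ep := hall _ hp0 hp1
  have h4 : s * t * (s * t) = s * t + s * s * (t * t) := by
    have : s * t * (s * t) = s * (t * s) * t := by simp only [mul_assoc]
    rw [this, hts']; noncomm_ring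
  have h5 : s * t = s + t := by
    rw [ep, es, et] at h4
    have : s * t + (s + 1) * (t + 1) = (s * t + s * t) + (s + t + 1) := by noncomm_ring
    rw [this, hadd, zero_add] at h4
    exact add_right_cancel h4
  have h6 : s * (s * t) = s * t + t := by rw [← mul_assoc, es, add_mul, one_mul]
  rw [h5, mul_add, es, h5, add_assoc s t t, hadd, add_zero, add_right_comm, ← add_assoc, hadd,
    zero_add] at h6
  apply hts1
  rw [← h6, add_assoc, hadd, add_zero]

theorem hasGoodScalars (hD : ∀ s : Finset D, s.card ≤ 5 → ∃ x, x ∉ s) : HasGoodScalars D := by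
  classical
  have two_ne_one : (2 : D) ≠ 1 := by
    intro h
    have h1 : (1 : D) = 2 - 1 := by norm_num
    rw [h, sub_self] at h1
    exact one_ne_zero h1
  have h4 : (2 : D) ≠ 0 → (4 : D) ≠ 0 := fun h => by
    have : (4 : D) = 2 * 2 := by norm_num
    rw [this]; exact mul_ne_zero h h
  have three : (3 : D) = 0 → ∃ e : D, e ≠ 0 ∧ e ≠ 1 ∧ e ≠ -1 ∧ e * e ≠ -1 := by
    intro h3
    obtain ⟨x, hx⟩ := hD {0, 1, -1} (Finset.card_le_three.trans (by norm_num))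
    simp only [Finset.mem_insert, Finset.mem_singleton, not_or] at hx
    exact exists_mul_self_ne_neg_one_of_three h3 hx.1 hx.2.1 hx.2.2
  constructor
  · intro h2
    by_cases h3 : (3 : D) = 0
    · exact three h3
    by_cases h5 : (5 : D) = 0
    -- In characteristic five, `±2` are the square roots of `-1`, as `x² + 1 = (x - 2)(x + 2)`.
    · obtain ⟨x, hx⟩ := hD {0, 1, -1, 2, -2} Finset.card_le_five
      simp only [Finset.mem_insert, Finset.mem_singleton, not_or] at hx
      obtain ⟨x0, x1, x2, x3, x4⟩ := hx
      refine ⟨x, x0, x1, x2, fun h => ?_⟩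
      have : (x - 2) * (x + 2) = x * x - -1 - 5 := by
        have t2 : (2 : D) = 1 + 1 := by norm_num
        have t5 : (5 : D) = 1 + 1 + 1 + 1 + 1 := by norm_num
        rw [t2, t5]; noncomm_ring
      rw [h, h5, sub_self, sub_zero, mul_eq_zero] at this
      rcases this with h | h
      · exact x3 (sub_eq_zero.1 h)
      · exact x4 (eq_neg_of_add_eq_zero_left h)
    · refine ⟨2, h2, two_ne_one, fun h => h3 ?_, fun h => h5 ?_⟩
      · have : (3 : D) = 2 - -1 := by norm_num
        rw [this, h, sub_self]
      · have : (5 : D) = 2 * 2 - -1 := by norm_num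
        rw [this, h, sub_self]
  · by_cases h2 : (2 : D) = 0
    · obtain ⟨x, hx0, hx1, hx⟩ := exists_mul_self_ne_add_one h2 hD
      refine ⟨x, hx0, hx1, fun h => hx ?_, ?_⟩
      · have : x * x = x * x - x + 1 + 2 * x - x - 1 := by noncomm_ring
        rw [this, h, h2]
        have : x + 1 = 2 * (x + 1) - x - 1 := by noncomm_ring
        rw [this, h2]; simp
      · have : (3 : D) = 2 + 1 := by norm_num
        rw [this, h2]; simpa using hx0
    by_cases h3 : (3 : D) = 0
    · obtain ⟨e, e0, e1, em, ee⟩ := three h3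
      refine ⟨e, e0, e1, ?_, ?_⟩
      -- In characteristic three the two polynomials become `(e + 1)²` and `2 (e² + 1)`.
      · have : e * e - e + 1 = (e + 1) * (e + 1) - 3 * e := by noncomm_ring
        rw [this, h3, zero_mul, sub_zero]
        have := fun h => em (eq_neg_of_add_eq_zero_left h)
        exact mul_ne_zero this this
      · have : 2 * (e * e) - 3 * e + 2 = 2 * (e * e + 1) - 3 * e := by
          have t2 : (2 : D) = 1 + 1 := by norm_num
          rw [t2]; noncomm_ring
        rw [this, h3, zero_mul, sub_zero]
        exact mul_ne_zero h2 fun h => ee (eq_neg_of_add_eq_zero_left h)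
    · refine ⟨2, h2, two_ne_one, ?_, ?_⟩
      · have : (2 * 2 - 2 + 1 : D) = 3 := by norm_num
        rwa [this]
      · have : (2 * (2 * 2) - 3 * 2 + 2 : D) = 4 := by norm_num
        rw [this]; exact h4 h2

end Scalars

/-! ### Transport along a lattice isomorphism. -/

section Transport

variable {D W L : Type*} [DivisionRing D] [AddCommGroup W] [Module D W] [Module.Finite D W]
  {n : ℕ} [CompleteLattice L]

/-- Conjugation of automorphisms by an isomorphism of ordered sets. -/
def conjAut {L L' : Type*} [Lattice L] [Lattice L'] (φ : L ≃o L') : (L' ≃o L') ≃* (L ≃o L) where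
  toFun g := (φ.trans g).trans φ.symm
  invFun g := (φ.symm.trans g).trans φ
  left_inv g := by ext x; simp
  right_inv g := by ext x; simp
  map_mul' g h := by
    refine DFunLike.ext _ _ fun x => ?_
    change φ.symm (g (h (φ x))) = φ.symm (g (φ (φ.symm (h (φ x)))))
    simp

theorem conjAut_apply_eq_iff {L L' : Type*} [Lattice L] [Lattice L'] (φ : L ≃o L') (g : L' ≃o L')
    (x : L) : conjAut φ g x = x ↔ g (φ x) = φ x := by
  change φ.symm (g (φ x)) = x ↔ _
  rw [OrderIso.symm_apply_eq]

theorem existsUnique_relation_of_orderIso (hW : IsAdmissible D W)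
    (φ : L ≃o Submodule D (Fin n → W)) {e : Fin n → L} (he : ∀ i, φ (e i) = lineSub D W i)
    {F : Subgroup (L ≃o L)} (hF : diagonalSubgroup e ≤ F) :
    ∃! r : Fin n → Fin n → Prop, ((∀ i, r i i) ∧ ∀ i j k, r i j → r j k → r i k) ∧
      pointwiseStabilizer (associatedLattice (relCollection e r)) ≤ F ∧
      F ≤ Subgroup.normalizer
        (pointwiseStabilizer (associatedLattice (relCollection e r)) : Set _) := by
  have hsup : ∀ (r : Fin n → Fin n → Prop) i, φ (⨆ j, relCollection e r i j) =
      ⨆ j, relCollection (lineSub D W) r i j := by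
    intro r i
    rw [OrderIso.map_iSup]
    refine iSup_congr fun j => ?_
    by_cases h : r j i
    · simp [relCollection, h, he]
    · simp [relCollection, h]
  have hstab : ∀ r : Fin n → Fin n → Prop,
      pointwiseStabilizer (associatedLattice (relCollection (lineSub D W) r)) =
        (pointwiseStabilizer (associatedLattice (relCollection e r))).comap
          (conjAut φ).toMonoidHom := by
    intro r
    ext g
    rw [Subgroup.mem_comap, mem_pointwiseStabilizer_associatedLattice,
      mem_pointwiseStabilizer_associatedLattice]
    refine forall_congr' fun i => ?_
    rw [← hsup]
    exact (conjAut_apply_eq_iff φ g _).symm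
  have hsurj : Function.Surjective (conjAut φ).toMonoidHom := (conjAut φ).surjective
  have hF' : diagonalSubgroup (lineSub D W) ≤ F.comap (conjAut φ).toMonoidHom := by
    intro g hg
    rw [mem_diagonalSubgroup] at hg
    refine hF (mem_diagonalSubgroup.2 fun i => ?_)
    exact (conjAut_apply_eq_iff φ g _).2 (by rw [he]; exact hg i)
  have key := existsUnique_relation hW hF'
  simp only [hstab, Subgroup.comap_le_comap_of_surjective hsurj,
    ← Subgroup.comap_normalizer_eq_of_surjective _ hsurj] at key
  exact key

end Transport

end LatticeNets

namespace LatticeNets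

/-! ### From modules over a matrix ring to spaces of columns. -/

section Morita

variable {T : Type*} [DivisionRing T] {m n : ℕ} {M : Type*} [AddCommGroup M]
  [Module (Matrix (Fin m) (Fin m) T)ᵐᵒᵖ M]

/-- The column number `q` of an element of a free right module over a matrix ring. -/
noncomputable def column (b : Module.Basis (Fin n) (Matrix (Fin m) (Fin m) T)ᵐᵒᵖ M) (q : Fin m) (x : M) :
    Fin n → Fin m → Tᵐᵒᵖ :=
  fun i p => MulOpposite.op ((b.repr x i).unop p q)

/-- The element of a free right module over a matrix ring with `y` as its column number `q` and
all other columns zero. -/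
noncomputable def ofColumn (b : Module.Basis (Fin n) (Matrix (Fin m) (Fin m) T)ᵐᵒᵖ M)
    (q : Fin m) (y : Fin n → Fin m → Tᵐᵒᵖ) : M :=
  b.equivFun.symm fun i =>
    MulOpposite.op (Matrix.of fun p q' => if q' = q then (y i p).unop else 0)

variable (b : Module.Basis (Fin n) (Matrix (Fin m) (Fin m) T)ᵐᵒᵖ M)

theorem repr_ofColumn (q : Fin m) (y : Fin n → Fin m → Tᵐᵒᵖ) (i : Fin n) (p q' : Fin m) :
    (b.repr (ofColumn b q y) i).unop p q' = if q' = q then (y i p).unop else 0 := by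
  have : b.repr (ofColumn b q y) i = b.equivFun (ofColumn b q y) i := rfl
  rw [this, ofColumn, LinearEquiv.apply_symm_apply]
  rfl

theorem ext_column {x x' : M} (h : ∀ q, column b q x = column b q x') : x = x' := by
  apply b.repr.injective
  ext i : 1
  apply MulOpposite.unop_injective
  ext p q
  exact MulOpposite.op_injective (congrFun (congrFun (h q) i) p)

theorem column_add (q : Fin m) (x x' : M) :
    column b q (x + x') = column b q x + column b q x' := by
  funext i p; simp [column]

theorem column_zero (q : Fin m) : column b q 0 = 0 := by
  funext i p; simp [column]

theorem column_smul (q : Fin m) (s : Matrix (Fin m) (Fin m) T) (x : M) :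
    column b q (MulOpposite.op s • x) = ∑ k, MulOpposite.op (s k q) • column b k x := by
  funext i p
  simp [column, Matrix.mul_apply, Finset.op_sum, Finset.sum_apply]

theorem column_ofColumn (q q' : Fin m) (y : Fin n → Fin m → Tᵐᵒᵖ) :
    column b q' (ofColumn b q y) = if q' = q then y else 0 := by
  funext i p
  rw [column, repr_ofColumn]
  split_ifs <;> simp

theorem ofColumn_add (q : Fin m) (y y' : Fin n → Fin m → Tᵐᵒᵖ) :
    ofColumn b q (y + y') = ofColumn b q y + ofColumn b q y' := by
  refine ext_column b fun q' => ?_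
  rw [column_add, column_ofColumn, column_ofColumn, column_ofColumn]
  split_ifs <;> simp

theorem ofColumn_zero (q : Fin m) : ofColumn b q 0 = 0 := by
  refine ext_column b fun q' => ?_
  rw [column_ofColumn, column_zero, ite_self]

theorem ofColumn_smul (q : Fin m) (t : T) (y : Fin n → Fin m → Tᵐᵒᵖ) :
    ofColumn b q (MulOpposite.op t • y) =
      MulOpposite.op (Matrix.single q q t) • ofColumn b q y := by
  refine ext_column b fun q' => ?_
  rw [column_smul, Finset.sum_eq_single q]
  · rw [column_ofColumn, column_ofColumn, if_pos rfl, Matrix.single_apply]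
    by_cases h : q' = q
    · simp [h]
    · simp [h, Ne.symm h]
  · intro k _ hk
    rw [column_ofColumn, if_neg hk, smul_zero]
  · simp

/-- Right multiplication by a matrix unit moves one column and kills the others; hence a submodule
is determined by the columns of its members, whatever their position. -/
theorem ofColumn_column (q q' : Fin m) (x : M) :
    ofColumn b q' (column b q x) =
      MulOpposite.op (Matrix.single q q' (1 : T)) • x := by
  refine ext_column b fun k => ?_
  rw [column_smul, Finset.sum_eq_single q, column_ofColumn, Matrix.single_apply]
  · by_cases h : k = q'
    · simp [h]
    · simp [h, Ne.symm h]
  · intro l _ hl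
    rw [Matrix.single_apply, if_neg fun h => hl h.1.symm]; simp
  · simp

theorem sum_ofColumn_column (x : M) : ∑ q, ofColumn b q (column b q x) = x := by
  simp only [ofColumn_column, ← Finset.sum_smul, ← Finset.op_sum]
  have : ∑ q : Fin m, Matrix.single q q (1 : T) = 1 := by
    ext i j
    rw [Matrix.sum_apply, Finset.sum_eq_single i]
    · simp [Matrix.single_apply, Matrix.one_apply]
    · intro k _ hk; simp [hk]
    · simp
  rw [this]; simp

/-- The lattice of submodules of a free right module over a matrix ring is isomorphic to the
lattice of subspaces of the space of columns. -/
noncomputable def columnOrderIso (hm : 1 ≤ m) :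
    Submodule (Matrix (Fin m) (Fin m) T)ᵐᵒᵖ M ≃o Submodule Tᵐᵒᵖ (Fin n → Fin m → Tᵐᵒᵖ) where
  toFun N :=
    { carrier := {y | ∀ q, ofColumn b q y ∈ N}
      add_mem' := fun hy hy' q => by rw [ofColumn_add]; exact N.add_mem (hy q) (hy' q)
      zero_mem' := fun q => by rw [ofColumn_zero]; exact N.zero_mem
      smul_mem' := fun c y hy q => by
        rw [← MulOpposite.op_unop c, ofColumn_smul]; exact N.smul_mem _ (hy q) }
  invFun U :=
    { carrier := {x | ∀ q, column b q x ∈ U}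
      add_mem' := fun hx hx' q => by rw [column_add]; exact U.add_mem (hx q) (hx' q)
      zero_mem' := fun q => by rw [column_zero]; exact U.zero_mem
      smul_mem' := fun c x hx q => by
        rw [← MulOpposite.op_unop c, column_smul]
        exact U.sum_mem fun k _ => U.smul_mem _ (hx k) }
  left_inv N := by
    ext x
    refine ⟨fun hx => ?_, fun hx q q' => ?_⟩
    · rw [← sum_ofColumn_column b x]
      exact N.sum_mem fun q _ => hx q q
    · rw [ofColumn_column]; exact N.smul_mem _ hx
  right_inv U := by
    ext y
    refine ⟨fun hy => ?_, fun hy q q' => ?_⟩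
    · have := hy ⟨0, hm⟩ ⟨0, hm⟩
      rwa [column_ofColumn, if_pos rfl] at this
    · rw [column_ofColumn]
      split_ifs
      · exact hy
      · exact U.zero_mem
  map_rel_iff' := by
    intro N N'
    refine ⟨fun h x hx => ?_, fun h y hy q => h (hy q)⟩
    rw [← sum_ofColumn_column b x]
    refine N'.sum_mem fun q _ => ?_
    have hmem : ∀ q', ofColumn b q' (column b q x) ∈ N := fun q' => by
      rw [ofColumn_column]; exact N.smul_mem _ hx
    exact h hmem q

theorem columnOrderIso_basisLine (hm : 1 ≤ m) (i : Fin n) :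
    columnOrderIso b hm (basisLine b i) = lineSub Tᵐᵒᵖ (Fin m → Tᵐᵒᵖ) i := by
  rw [eq_comm, ← OrderIso.symm_apply_eq]
  ext x
  constructor
  · intro hx
    have h0 : ∀ j, j ≠ i → b.repr x j = 0 := by
      intro j hj
      apply MulOpposite.unop_injective
      ext p q
      have : column b q x j p = 0 := congrFun (hx q j hj) p
      exact MulOpposite.op_injective this
    have h1 : x = b.repr x i • b i := by
      conv_lhs => rw [← b.sum_repr x]
      exact Finset.sum_eq_single i (fun j _ hj => by rw [h0 j hj, zero_smul]) (by simp)
    rw [h1]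
    exact Submodule.smul_mem _ _ (Submodule.mem_span_singleton_self _)
  · intro hx q j hj
    obtain ⟨c, rfl⟩ := Submodule.mem_span_singleton.1 hx
    have : j ≠ i := hj
    funext p
    simp [column, this.symm]

end Morita

/-! ### Nets over a simple ring as preorders. -/

section Nets

variable {R : Type*} [Ring R] {M : Type*} [AddCommGroup M] [Module Rᵐᵒᵖ M] {n : ℕ}

theorem transposedCollection_of_top (b : Module.Basis (Fin n) Rᵐᵒᵖ M)
    {σ : Fin n → Fin n → TwoSidedIdeal R} {i j : Fin n} (h : σ j i = ⊤) :
    transposedCollection b σ i j = basisLine b j := by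
  rw [transposedCollection, basisLine, h]
  refine le_antisymm (Submodule.span_le.2 ?_) (Submodule.span_mono ?_)
  · rintro _ ⟨r, -, rfl⟩
    exact Submodule.smul_mem _ _ (Submodule.mem_span_singleton_self _)
  · rintro _ rfl
    exact ⟨1, trivial, by simp⟩

theorem transposedCollection_of_bot (b : Module.Basis (Fin n) Rᵐᵒᵖ M)
    {σ : Fin n → Fin n → TwoSidedIdeal R} {i j : Fin n} (h : σ j i = ⊥) :
    transposedCollection b σ i j = ⊥ := by
  rw [transposedCollection, h, Submodule.span_eq_bot]
  rintro _ ⟨r, hr, rfl⟩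
  rw [TwoSidedIdeal.mem_bot] at hr
  simp [hr]

variable [IsSimpleRing R]

theorem transposedCollection_eq_relCollection (b : Module.Basis (Fin n) Rᵐᵒᵖ M)
    (σ : Fin n → Fin n → TwoSidedIdeal R) :
    transposedCollection b σ = relCollection (basisLine b) fun i j => σ i j = ⊤ := by
  funext i j
  rcases eq_bot_or_eq_top (σ j i) with h | h
  · rw [transposedCollection_of_bot b h]
    simp [relCollection, h]
  · rw [transposedCollection_of_top b h]
    simp [relCollection, h]

theorem isDNet_iff {σ : Fin n → Fin n → TwoSidedIdeal R} :
    IsDNet σ ↔ (∀ i, σ i i = ⊤) ∧ ∀ i j k, σ i j = ⊤ → σ j k = ⊤ → σ i k = ⊤ := by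
  refine ⟨fun h => ⟨h.diag, fun i j k hij hjk => ?_⟩, fun h => ⟨fun i k j a ha c hc => ?_, h.1⟩⟩
  · have h1 := h.mul_mem i j k 1 (hij ▸ trivial) 1 (hjk ▸ trivial)
    rw [one_mul] at h1
    exact (TwoSidedIdeal.one_mem_iff _).1 h1
  · rcases eq_bot_or_eq_top (σ i k) with hik | hik
    · rw [hik, TwoSidedIdeal.mem_bot] at ha
      rw [ha, zero_mul]; exact (σ i j).zero_mem
    rcases eq_bot_or_eq_top (σ k j) with hkj | hkj
    · rw [hkj, TwoSidedIdeal.mem_bot] at hc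
      rw [hc, mul_zero]; exact (σ i j).zero_mem
    rw [h.2 i k j hik hkj]; trivial

omit [IsSimpleRing R] in
theorem support_bot (b : Module.Basis (Fin n) Rᵐᵒᵖ M) (j : Fin n) :
    support (basisLine b) ⊥ j = ⊥ := by
  rw [support, bot_sup_eq, eq_bot_iff]
  rintro x ⟨hx1, hx2⟩
  have h1 : (⨆ k : {k : Fin n // k ≠ j}, basisLine b k) ≤
      LinearMap.ker (b.coord j) := by
    refine iSup_le fun k => Submodule.span_le.2 ?_
    rintro _ rfl
    simp [k.2]
  obtain ⟨c, rfl⟩ := Submodule.mem_span_singleton.1 hx2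
  have h2 := h1 hx1
  simp at h2
  simp [h2]

/-- The transpose of a `D`-net of ideals of a simple ring is a net collection. -/
theorem IsDNet.isNetCollection (b : Module.Basis (Fin n) Rᵐᵒᵖ M)
    {σ : Fin n → Fin n → TwoSidedIdeal R} (h : IsDNet σ) :
    IsNetCollection (basisLine b) (transposedCollection b σ) where
  le_atom i j := by
    rcases eq_bot_or_eq_top (σ j i) with h | h
    · rw [transposedCollection_of_bot b h]; exact bot_le
    · rw [transposedCollection_of_top b h]
  diag i := transposedCollection_of_top b (h.diag i)
  mem_fixed i j := by
    intro f hf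
    rcases eq_bot_or_eq_top (σ j i) with h | h
    · rw [transposedCollection_of_bot b h]; exact map_bot f
    · rw [transposedCollection_of_top b h]; exact mem_diagonalSubgroup.1 hf j
  support_iff i j g := by
    refine ⟨fun hg k => ?_, fun hg => ?_⟩
    · rcases eq_bot_or_eq_top (σ i k) with hik | hik
      · rw [transposedCollection_of_bot b hik, map_bot, support_bot]; exact bot_le
      · rw [transposedCollection_of_top b hik]
        refine hg.trans ?_
        rcases eq_bot_or_eq_top (σ j i) with hji | hji
        · rw [transposedCollection_of_bot b hji]; exact bot_le
        · rw [transposedCollection_of_top b hji,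
            transposedCollection_of_top b ((isDNet_iff.1 h).2 j i k hji hik)]
    -- The choice `k = i` suffices, because `τ i i = e i`.
    · have := hg i
      rwa [transposedCollection_of_top b (h.diag i)] at this

open Classical in
theorem existsUnique_isDNet_of_relation {P : (Fin n → Fin n → Prop) → Prop}
    (h : ∃! r : Fin n → Fin n → Prop,
      ((∀ i, r i i) ∧ ∀ i j k, r i j → r j k → r i k) ∧ P r) :
    ∃! σ : Fin n → Fin n → TwoSidedIdeal R, IsDNet σ ∧ P fun i j => σ i j = ⊤ := by
  obtain ⟨r, ⟨hr, hP⟩, hu⟩ := h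
  have hrel : (fun i j => (if r i j then ⊤ else ⊥ : TwoSidedIdeal R) = ⊤) = r := by
    funext i j
    by_cases hij : r i j <;> simp [hij]
  refine ⟨fun i j => if r i j then ⊤ else ⊥, ⟨?_, ?_⟩, ?_⟩
  · rw [isDNet_iff]
    have h1 : ∀ i j, ((if r i j then ⊤ else ⊥ : TwoSidedIdeal R) = ⊤) = r i j := congrFun₂ hrel
    simpa only [h1] using hr
  · simpa only [hrel] using hP
  · rintro σ ⟨hσ, hPσ⟩
    have h1 := hu _ ⟨isDNet_iff.1 hσ, hPσ⟩
    funext i j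
    rw [← h1]
    rcases eq_bot_or_eq_top (σ i j) with h | h <;> simp [h]

end Nets

/-! ### The excluded rings and admissibility. -/

section Cardinality

variable {T : Type*} [DivisionRing T]

/-- A division ring with at most five elements is one of the four excluded fields. -/
theorem exists_notMem_of_isEmpty_ringEquiv (h2 : IsEmpty (T ≃+* ZMod 2))
    (h3 : IsEmpty (T ≃+* ZMod 3)) (h4 : IsEmpty (T ≃+* GaloisField 2 2))
    (h5 : IsEmpty (T ≃+* ZMod 5)) (s : Finset Tᵐᵒᵖ) (hs : s.card ≤ 5) : ∃ x, x ∉ s := by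
  by_contra! hall
  have : Fintype Tᵐᵒᵖ := ⟨s, hall⟩
  have : Fintype T := Fintype.ofEquiv _ MulOpposite.opEquiv.symm
  have hcard : Fintype.card T ≤ 5 := by
    rw [Fintype.card_congr (MulOpposite.opEquiv (α := T))]
    exact (Finset.card_le_card fun x _ => hall x).trans hs
  have hone : 1 < Fintype.card T := Fintype.one_lt_card
  have hprime : ∀ p : ℕ, p.Prime → Fintype.card T = p → IsEmpty (T ≃+* ZMod p) → False :=
    fun p hp hc he => he.false (ZMod.ringEquivOfPrime T hp hc).symm
  generalize hc : Fintype.card T = c at *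
  interval_cases c
  · exact hprime 2 Nat.prime_two rfl h2
  · exact hprime 3 Nat.prime_three rfl h3
  · have : Fintype (GaloisField 2 2) := Fintype.ofFinite _
    refine h4.false (FiniteField.ringEquivOfCardEq ?_)
    have := GaloisField.card 2 2 two_ne_zero
    rw [Nat.card_eq_fintype_card] at this
    rw [hc, this]; rfl
  · exact hprime 5 Nat.prime_five rfl h5

theorem exists_ne_zero_ne_one_of_isEmpty_ringEquiv (h2 : IsEmpty (T ≃+* ZMod 2)) :
    ∃ c : Tᵐᵒᵖ, c ≠ 0 ∧ c ≠ 1 := by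
  classical
  by_contra! hall
  have hT : ∀ x : T, x ∈ ({0, 1} : Finset T) := by
    intro x
    have := hall (MulOpposite.op x)
    by_cases hx : x = 0
    · simp [hx]
    · have h1 := this (by simpa using hx)
      simp [MulOpposite.op_injective h1]
  have : Fintype T := ⟨{0, 1}, hT⟩
  have hcard : Fintype.card T ≤ 2 := (Finset.card_le_card fun x _ => hT x).trans Finset.card_le_two
  have hone : 1 < Fintype.card T := Fintype.one_lt_card
  exact h2.false (ZMod.ringEquivOfPrime T Nat.prime_two (by omega)).symm

theorem isAdmissible_of_isEmpty_ringEquiv {m : ℕ} (hm : 1 ≤ m)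
    (hF2 : IsEmpty (Matrix (Fin m) (Fin m) T ≃+* ZMod 2))
    (hF3 : IsEmpty (Matrix (Fin m) (Fin m) T ≃+* ZMod 3))
    (hF4 : IsEmpty (Matrix (Fin m) (Fin m) T ≃+* GaloisField 2 2))
    (hF5 : IsEmpty (Matrix (Fin m) (Fin m) T ≃+* ZMod 5))
    (hM2 : IsEmpty (Matrix (Fin m) (Fin m) T ≃+* Matrix (Fin 2) (Fin 2) (ZMod 2))) :
    IsAdmissible Tᵐᵒᵖ (Fin m → Tᵐᵒᵖ) := by
  have hrank : Module.finrank Tᵐᵒᵖ (Fin m → Tᵐᵒᵖ) = m := Module.finrank_fin_fun _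
  rw [IsAdmissible, hrank]
  by_cases h1 : m = 1
  · subst h1
    have e : T ≃+* Matrix (Fin 1) (Fin 1) T := Matrix.uniqueRingEquiv.symm
    refine Or.inr ⟨rfl, hasGoodScalars (exists_notMem_of_isEmpty_ringEquiv ?_ ?_ ?_ ?_)⟩
    · exact ⟨fun f => hF2.false (e.symm.trans f)⟩
    · exact ⟨fun f => hF3.false (e.symm.trans f)⟩
    · exact ⟨fun f => hF4.false (e.symm.trans f)⟩
    · exact ⟨fun f => hF5.false (e.symm.trans f)⟩
  · refine Or.inl ⟨by omega, ?_⟩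
    rintro rfl
    exact exists_ne_zero_ne_one_of_isEmpty_ringEquiv ⟨fun f => hM2.false f.mapMatrix⟩

end Cardinality

end LatticeNets

theorem theorem1 {T : Type*} [DivisionRing T] (m n : ℕ) (hm : 1 ≤ m) (hn : 2 ≤ n)
    (hF2 : IsEmpty (Matrix (Fin m) (Fin m) T ≃+* ZMod 2))
    (hF3 : IsEmpty (Matrix (Fin m) (Fin m) T ≃+* ZMod 3))
    (hF4 : IsEmpty (Matrix (Fin m) (Fin m) T ≃+* GaloisField 2 2))
    (hF5 : IsEmpty (Matrix (Fin m) (Fin m) T ≃+* ZMod 5))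
    (hM2 : IsEmpty (Matrix (Fin m) (Fin m) T ≃+* Matrix (Fin 2) (Fin 2) (ZMod 2)))
    {M : Type*} [AddCommGroup M] [Module (Matrix (Fin m) (Fin m) T)ᵐᵒᵖ M]
    (b : Module.Basis (Fin n) (Matrix (Fin m) (Fin m) T)ᵐᵒᵖ M) :
    (∀ σ : Fin n → Fin n → TwoSidedIdeal (Matrix (Fin m) (Fin m) T), LatticeNets.IsDNet σ →
      LatticeNets.IsNetCollection (LatticeNets.basisLine b)
        (LatticeNets.transposedCollection b σ)) ∧
    ∀ F : Subgroup (Submodule (Matrix (Fin m) (Fin m) T)ᵐᵒᵖ M ≃o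
        Submodule (Matrix (Fin m) (Fin m) T)ᵐᵒᵖ M),
      LatticeNets.diagonalSubgroup (LatticeNets.basisLine b) ≤ F →
      ∃! σ : Fin n → Fin n → TwoSidedIdeal (Matrix (Fin m) (Fin m) T),
        LatticeNets.IsDNet σ ∧
        LatticeNets.pointwiseStabilizer (LatticeNets.netLattice b σ) ≤ F ∧
        F ≤ Subgroup.normalizer
          (LatticeNets.pointwiseStabilizer (LatticeNets.netLattice b σ) : Set _) := by
  -- Nonemptiness makes the matrix ring simple.
  have : Nonempty (Fin m) := ⟨⟨0, hm⟩⟩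
  refine ⟨fun σ hσ => hσ.isNetCollection b, fun F hF => ?_⟩
  have hW := LatticeNets.isAdmissible_of_isEmpty_ringEquiv hm hF2 hF3 hF4 hF5 hM2
  simp only [LatticeNets.netLattice, LatticeNets.transposedCollection_eq_relCollection]
  exact LatticeNets.existsUnique_isDNet_of_relation
    (LatticeNets.existsUnique_relation_of_orderIso hW (LatticeNets.columnOrderIso b hm)
      (LatticeNets.columnOrderIso_basisLine b hm) hF)
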